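/- **Conventions.** A *manifold* is a Hausdorff, second countable smooth manifold modelled on Fréchet spaces and having smooth bump functions (for every point $m$ and open $U\ni m$ there is a smooth $f\ge 0$ with $f(m)=1$ and $f=0$ off $U$); in finite dimensions the last condition is automatic, and the dimension may vary from point to point. A *submersion* is a smooth map that is locally, in charts, a linear projection $W\times K\to W$. For a surjective submersion $A\to B$ let $A^{[k]}=A\times_B\cdots\times_B A$, with $d_i$ omitting the $(i+1)$-st factor. In a (semi)simplicial manifold, $\delta=\sum_i(-1)^id_i^*$ on forms and $\delta P=d_0^*P\otimes d_1^*P^*\otimes d_2^*P\otimes\cdots$ on $U(1)$-bundles; $\delta^2P$ has a canonical section, obtained by pairing mutually dual factors. Connections are real-valued $1$-forms on total spaces, via $\mathfrak u(1)\cong\mathbb R$. A *bundle gerbe* $(E,Z)$ on $B$, for a surjective submersion $Z\to B$, is a $U(1)$-bundle $E\to Z^{[2]}$ with a section $m$ of $\delta E\to Z^{[3]}$ such that $\delta(m)$ is the canonical section of $\delta^2E\to Z^{[4]}$. A *bundle gerbe connection* is a connection $\nabla$ on $E$ with $m^*\delta\nabla=0$; a *curving* for it is $\beta\in\Omega^2(Z)$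 whose $\delta\beta\in\Omega^2(Z^{[2]})$ is the curvature of $\nabla$, i.e. $\pi^*\delta\beta=d\nabla$ on $E$. Let $X$ be a manifold. A *rigid bundle 2-gerbe* on $X$ consists of: a surjective submersion $\pi:Y\to X$ of manifolds; a 3-truncated simplicial manifold $Z_\bullet$ with a simplicial map $\pi:Z_\bullet\to Y^{[\bullet+1]}$ that is a surjective submersion in each degree (write $\delta_h$ for the simplicial direction and $\delta_v$ for the direction of the fibre products $Z_n^{[k]}$ over $Y^{[n+1]}$); a bundle gerbe $(E,Z_1)$ on $Y^{[2]}$ with multiplication $m\in\Gamma(\delta_vE)$; and a section $M$ of $\delta_hE\to Z_2^{[2]}$ with $\delta_v(M)=\delta_h(m)$ over $Z_2^{[3]}$ and $\delta_h(M)=1$, the canonical section of $\delta_h^2E$, over $Z_3^{[2]}$. A *trivialisation* $(F,t)$ of it consists of a bundle gerbe $(F,Z_0)$ on $Y$ and an isomorphism $t:E\to\delta_hF$ of $U(1)$-bundles over $Z_1^{[2]}$, compatible with the bundle gerbe multiplications, such that the section $\delta_h(t)\circ M$ of $\delta_h^2F\to Z_2^{[2]}$ is the canonical section. A *rigid connective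 structure* $(\nabla_E,\beta,\lambda,\alpha)$ consists of a bundle gerbe connection $\nabla_E$ on $E$, a curving $\beta\in\Omega^2(Z_1)$ for it, a $3$-form $\lambda\in\Omega^3(Y)$ with $\pi^*\delta_h\lambda=d\beta$, and a $1$-form $\alpha\in\Omega^1(Z_2)$ with $\delta_v\alpha=M^*\delta_h\nabla_E$, $d\alpha=\delta_h\beta$ and $\delta_h\alpha=0$. A *trivialisation connective structure* $(\nabla_F,a,b)$ consists of a bundle gerbe connection $\nabla_F$ on $F$, a curving $b\in\Omega^2(Z_0)$ for it, and a $1$-form $a\in\Omega^1(Z_1)$ with $$\pi^*\delta_va=\nabla_E-t^*\delta_h\nabla_F\ \text{ on }E,\qquad da=\beta-\delta_hb .$$ **Proposition.** Let a rigid bundle 2-gerbe on $X$ be given, with a rigid connective structure $(\nabla_E,\beta,\lambda,\alpha)$ and a trivialisation $(F,t)$. Then a trivialisation connective structure $(\nabla_F,a,b)$ exists. As a consequence the 4-curvature is exact, with an explicit primitive: there is a unique $H\in\Omega^4(X)$ with $\pi^*H=d\lambda$ (the 4-curvature), and $dH=0$. For every trivialisation connective structure $(\nabla_F,a,b)$ there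 is a unique $h\in\Omega^3(Y)$ with $\pi^*h=db$ on $Z_0$; it satisfies $dh=0$ and $\pi^*\delta_hh=d\beta$. There is a unique $R\in\Omega^3(X)$ with $\pi^*R=\lambda-h$, and $dR=H$. -/

import Mathlib

open scoped ContDiff
open Diffeology

noncomputable section

namespace RigidGerbe

/-- Cartesian space `ℝⁿ`. -/
abbrev Euc (n : ℕ) : Type := EuclideanSpace ℝ (Fin n)

/-! ### Diffeologies on subspaces, products and the circle -/

section Constructions

variable {X Y : Type*}

/-- The diffeology induced by a map `f : X → Y`: a map into `X` is a plot iff its composite with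
`f` is one. -/
@[reducible]
def inducedDiffeology (f : X → Y) [DiffeologicalSpace Y] : DiffeologicalSpace X where
  plots n := {p : Euc n → X | IsPlot (f ∘ p)}
  constant_plots x := isPlot_const (x := f x)
  plot_reparam hp hf := isPlot_reparam (X := Y) hp hf
  locality hp := DiffeologicalSpace.locality (X := Y) fun x => by
    obtain ⟨u, hu, hxu, h⟩ := hp x
    exact ⟨u, hu, hxu, fun hfu hf => h hfu hf⟩

instance subtypeDiffeology [DiffeologicalSpace X] (P : X → Prop) :
    DiffeologicalSpace {x : X // P x} :=
  inducedDiffeology Subtype.val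

instance prodDiffeology [DiffeologicalSpace X] [DiffeologicalSpace Y] :
    DiffeologicalSpace (X × Y) where
  plots n := {p : Euc n → X × Y | IsPlot (fun t => (p t).1) ∧ IsPlot (fun t => (p t).2)}
  constant_plots x := ⟨isPlot_const (x := x.1), isPlot_const (x := x.2)⟩
  plot_reparam hp hf := ⟨isPlot_reparam (X := X) hp.1 hf, isPlot_reparam (X := Y) hp.2 hf⟩
  locality hp :=
    ⟨DiffeologicalSpace.locality (X := X) fun x => by
      obtain ⟨u, hu, hxu, h⟩ := hp x
      exact ⟨u, hu, hxu, fun hfu hf => (h hfu hf).1⟩,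
    DiffeologicalSpace.locality (X := Y) fun x => by
      obtain ⟨u, hu, hxu, h⟩ := hp x
      exact ⟨u, hu, hxu, fun hfu hf => (h hfu hf).2⟩⟩

instance piDiffeology {ι : Type*} {A : ι → Type*} [∀ i, DiffeologicalSpace (A i)] :
    DiffeologicalSpace (∀ i, A i) where
  plots n := {p : Euc n → ∀ i, A i | ∀ i, IsPlot (fun t => p t i)}
  constant_plots x := fun i => isPlot_const (x := x i)
  plot_reparam hp hf := fun i => isPlot_reparam (X := A i) (hp i) hf
  locality hp := fun i => DiffeologicalSpace.locality (X := A i) fun x => by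
    obtain ⟨u, hu, hxu, h⟩ := hp x
    exact ⟨u, hu, hxu, fun hfu hf => h hfu hf i⟩

/-- The circle group `U(1)` with its diffeology as a subspace of `ℂ`. -/
instance circleDiffeology : DiffeologicalSpace Circle :=
  @inducedDiffeology Circle ℂ (fun z => (z : ℂ)) (NormedSpace.toDiffeology ℂ)

lemma isPlot_circle_iff {n : ℕ} {p : Euc n → Circle} :
    IsPlot p ↔ ContDiff ℝ ∞ (fun t => (p t : ℂ)) := Iff.rfl

lemma dSmooth_val [DiffeologicalSpace X] {P : X → Prop} :
    DSmooth (Subtype.val : {x : X // P x} → X) := fun _ _ hp => hp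

lemma dSmooth_fst [DiffeologicalSpace X] [DiffeologicalSpace Y] :
    DSmooth (Prod.fst : X × Y → X) := fun _ _ hp => hp.1

lemma dSmooth_snd [DiffeologicalSpace X] [DiffeologicalSpace Y] :
    DSmooth (Prod.snd : X × Y → Y) := fun _ _ hp => hp.2

lemma dSmooth_apply {ι : Type*} {A : ι → Type*} [∀ i, DiffeologicalSpace (A i)] (i : ι) :
    DSmooth (fun a : ∀ i, A i => a i) := fun _ _ hp => hp i

end Constructions

/-! ### Manifolds and submersions -/

section Manifolds

/-- Fréchet spaces: completely metrizable locally convex real vector spaces. -/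
class IsFrechet (V : Type*) [AddCommGroup V] [Module ℝ V] [TopologicalSpace V] : Prop
    extends IsTopologicalAddGroup V, ContinuousSMul ℝ V, LocallyConvexSpace ℝ V,
      TopologicalSpace.IsCompletelyMetrizableSpace V

/-- Smooth maps from `ℝⁿ` to a Fréchet space. In a Fréchet space a map is smooth iff its composites
with all continuous linear functionals are; for `V` of finite dimension this is `ContDiff ℝ ∞`. -/
def IsSmoothInto {V : Type*} [AddCommGroup V] [Module ℝ V] [TopologicalSpace V] {n : ℕ}
    (p : Euc n → V) : Prop :=
  ∀ l : V →L[ℝ] ℝ, ContDiff ℝ ∞ (fun t => l (p t))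

/-- A smooth chart: a homeomorphism `e` from an open subset of `M` to an open subset of `V` that is
a diffeomorphism, that is, for which smooth maps into the source correspond to smooth maps into the
target. -/
def IsChart {M V : Type*} [TopologicalSpace M] [DiffeologicalSpace M]
    [AddCommGroup V] [Module ℝ V] [TopologicalSpace V] (e : OpenPartialHomeomorph M V) : Prop :=
  ∀ (n : ℕ) (p : Euc n → M), (∀ t, p t ∈ e.source) → (IsPlot p ↔ IsSmoothInto (fun t => e (p t)))

/-- Smooth manifolds: Hausdorff second countable spaces locally diffeomorphic to open subsets of
Fréchet spaces, with enough smooth bump functions. The last condition is automatic for manifolds of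
finite dimension; the dimension may vary with the point. The smooth structure is recorded as the
diffeology of smooth maps `ℝⁿ → M`, whose D-topology is the topology of `M`. -/
class IsSmoothManifold (M : Type*) [TopologicalSpace M] [DiffeologicalSpace M] : Prop where
  t2 : T2Space M
  secondCountable : SecondCountableTopology M
  dTopology : IsDTopologyCompatible M
  exists_chart : ∀ m : M, ∃ (V : Type) (_ : AddCommGroup V) (_ : Module ℝ V)
    (_ : TopologicalSpace V) (_ : IsFrechet V) (e : OpenPartialHomeomorph M V),
    m ∈ e.source ∧ IsChart e
  exists_bump : ∀ (m : M) (U : Set M), IsOpen U → m ∈ U →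
    ∃ f : M → ℝ, DSmooth f ∧ f m = 1 ∧ (∀ x, 0 ≤ f x) ∧ ∀ x ∉ U, f x = 0

/-- `f` is a surjective submersion: it is smooth and surjective, and around every point there are
charts in which it is a linear projection `W × K → W`. -/
structure IsSurjSubmersion {M N : Type*} [TopologicalSpace M] [DiffeologicalSpace M]
    [TopologicalSpace N] [DiffeologicalSpace N] (f : M → N) : Prop where
  smooth : DSmooth f
  surjective : Function.Surjective f
  exists_charts : ∀ m : M, ∃ (W K : Type)
    (_ : AddCommGroup W) (_ : Module ℝ W) (_ : TopologicalSpace W) (_ : IsFrechet W)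
    (_ : AddCommGroup K) (_ : Module ℝ K) (_ : TopologicalSpace K) (_ : IsFrechet K)
    (e : OpenPartialHomeomorph M (W × K)) (c : OpenPartialHomeomorph N W),
    m ∈ e.source ∧ IsChart e ∧ IsChart c ∧
      ∀ x ∈ e.source, f x ∈ c.source ∧ c (f x) = (e x).1

end Manifolds

/-! ### Differential forms -/

section Forms

variable {X Y : Type*} [DiffeologicalSpace X] [DiffeologicalSpace Y]

/-- The real vector space of differential `k`-forms on a smooth space. A form assigns to every
smooth map `p : ℝⁿ → X` its pullback `p^*η`, a smooth `k`-form on `ℝⁿ`, subject to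
`(p ∘ f)^*η = f^*(p^*η)` for all smooth `f : ℝᵐ → ℝⁿ`. On manifolds this is the usual notion. -/
def diffForms (k : ℕ) (X : Type*) [DiffeologicalSpace X] :
    Submodule ℝ (∀ n : ℕ, {p : Euc n → X // IsPlot p} → Euc n → Euc n [⋀^Fin k]→L[ℝ] ℝ) where
  carrier := {η | (∀ n p, ContDiff ℝ ∞ (η n p)) ∧
    ∀ (m n : ℕ) (p : {p : Euc n → X // IsPlot p}) (f : Euc m → Euc n) (hf : ContDiff ℝ ∞ f)
      (t : Euc m), η m ⟨p.1 ∘ f, isPlot_reparam p.2 hf⟩ t =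
        (η n p (f t)).compContinuousLinearMap (fderiv ℝ f t)}
  zero_mem' := ⟨fun _ _ => contDiff_const, fun _ _ _ _ _ _ => by ext; simp⟩
  add_mem' ha hb := ⟨fun n p => (ha.1 n p).add (hb.1 n p), fun m n p f hf t => by
    ext v
    simp [ha.2 m n p f hf t, hb.2 m n p f hf t]⟩
  smul_mem' c η hη := ⟨fun n p => (hη.1 n p).const_smul c, fun m n p f hf t => by
    ext v
    simp [hη.2 m n p f hf t]⟩

/-- `Ω^k(X)`. -/
def Form (k : ℕ) (X : Type*) [DiffeologicalSpace X] : Type _ := diffForms k X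

instance (k : ℕ) : AddCommGroup (Form k X) := inferInstanceAs (AddCommGroup (diffForms k X))

instance (k : ℕ) : Module ℝ (Form k X) := inferInstanceAs (Module ℝ (diffForms k X))

@[ext]
lemma Form.ext {k : ℕ} {a b : Form k X}
    (h : ∀ (n : ℕ) (p : {p : Euc n → X // IsPlot p}) (t : Euc n), a.1 n p t = b.1 n p t) :
    a = b :=
  Subtype.ext (funext fun n => funext fun p => funext fun t => h n p t)

/-- The pullback `f^* : Ω^k(Y) → Ω^k(X)` along a smooth map. -/
def Form.pullback {k : ℕ} (f : X → Y) (hf : DSmooth f) : Form k Y →ₗ[ℝ] Form k X where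
  toFun η := ⟨fun n p => η.1 n ⟨f ∘ p.1, hf n p.1 p.2⟩, fun n p => η.2.1 n _,
    fun m n p g hg => η.2.2 m n ⟨f ∘ p.1, hf n p.1 p.2⟩ g hg⟩
  map_add' _ _ := rfl
  map_smul' _ _ := rfl

/-- The exterior derivative `d : Ω^k(X) → Ω^{k+1}(X)`. -/
def Form.d {k : ℕ} : Form k X →ₗ[ℝ] Form (k + 1) X where
  toFun η := ⟨fun n p => extDeriv (η.1 n p), fun n p => by
      have h : ContDiff ℝ ∞ (fderiv ℝ (η.1 n p)) :=
        (η.2.1 n p).fderiv_right (by simp)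
      exact (ContinuousAlternatingMap.alternatizeUncurryFinCLM ℝ (Euc n) ℝ).contDiff.comp h,
    fun m n p f hf t => by
      have h1 : η.1 m ⟨p.1 ∘ f, isPlot_reparam p.2 hf⟩ =
          fun s => (η.1 n p (f s)).compContinuousLinearMap (fderiv ℝ f s) :=
        funext fun s => η.2.2 m n p f hf s
      change extDeriv (η.1 m ⟨p.1 ∘ f, isPlot_reparam p.2 hf⟩) t = _
      rw [h1]
      exact extDeriv_pullback (r := ∞) ((η.2.1 n p).differentiable (by simp) _)
        hf.contDiffAt (by
          rw [minSmoothness_of_isRCLikeNormedField]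
          exact WithTop.coe_le_coe.2 le_top)⟩
  map_add' a b := by
    refine Form.ext fun n p t => ?_
    have := extDeriv_add (((a.2.1 n p).differentiable (by simp)) t)
      (((b.2.1 n p).differentiable (by simp)) t)
    exact this
  map_smul' c a := by
    refine Form.ext fun n p t => ?_
    have := extDeriv_smul c (a.1 n p) (x := t)
    exact this

/-- The Maurer–Cartan form of `U(1)`, as a real-valued form: `dθ` at `exp (i θ)`. -/
def maurerCartan : Form 1 Circle :=
  ⟨fun n p t => ContinuousAlternatingMap.ofSubsingleton ℝ (Euc n) ℝ (0 : Fin 1)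
      (Complex.imCLM ∘L (star (p.1 t : ℂ) • fderiv ℝ (fun s => (p.1 s : ℂ)) t)),
    fun n p => by
      have hp : ContDiff ℝ ∞ (fun s => (p.1 s : ℂ)) := p.2
      have h1 : ContDiff ℝ ∞ (fderiv ℝ (fun s => (p.1 s : ℂ))) := hp.fderiv_right (by simp)
      have h2 : ContDiff ℝ ∞ (fun s => star (p.1 s : ℂ)) := Complex.conjCLE.contDiff.comp hp
      exact (ContinuousAlternatingMap.ofSubsingletonLIE (𝕜 := ℝ) (E := Euc n) (F := ℝ)
        (0 : Fin 1)).contDiff.comp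
        (contDiff_const.clm_comp (h2.smul h1)),
    fun m n p f hf t => by
      have hp : ContDiff ℝ ∞ (fun s => (p.1 s : ℂ)) := p.2
      ext v
      have h := fderiv_comp t (hp.differentiable (by simp) (f t)) (hf.differentiable (by simp) t)
      have h' : fderiv ℝ (fun s => ((p.1 ∘ f) s : ℂ)) t =
          (fderiv ℝ (fun s => (p.1 s : ℂ)) (f t)).comp (fderiv ℝ f t) := h
      simp only [Function.comp_apply] at h'
      simp [h']⟩

end Forms

/-! ### Fibre products -/

section FibreProducts

variable {A B : Type*}

/-- The `k`-fold fibre product `A^{[k]} = A ×_B ⋯ ×_B A`. -/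
abbrev FibProd (π : A → B) (k : ℕ) : Type _ := {a : Fin k → A // ∀ i j, π (a i) = π (a j)}

/-- The projection of the fibre product onto a factor. -/
def FibProd.pr (π : A → B) {k : ℕ} (i : Fin k) (a : FibProd π k) : A := a.1 i

/-- The face map `d_i : A^{[k+1]} → A^{[k]}` omitting the factor with (zero-based) index `i`. -/
def FibProd.face (π : A → B) {k : ℕ} (i : Fin (k + 1)) (a : FibProd π (k + 1)) : FibProd π k :=
  ⟨fun j => a.1 (i.succAbove j), fun _ _ => a.2 _ _⟩

variable [DiffeologicalSpace A]

lemma FibProd.dSmooth_pr (π : A → B) {k : ℕ} (i : Fin k) : DSmooth (FibProd.pr π i) :=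
  fun _ _ hp => hp i

/-- `δ : Ω^k(A) → Ω^k(A^{[2]})`, `δη = d_0^*η - d_1^*η`, where `d_0` omits the first factor and
`d_1` the second one. -/
def delta (π : A → B) {k : ℕ} : Form k A →ₗ[ℝ] Form k (FibProd π 2) :=
  Form.pullback (k := k) (FibProd.pr π (1 : Fin 2)) (FibProd.dSmooth_pr π 1) -
    Form.pullback (k := k) (FibProd.pr π (0 : Fin 2)) (FibProd.dSmooth_pr π 0)

end FibreProducts

/-! ### `U(1)`-bundles, connections, and sections of tensor products -/

section Bundles

universe u v

/-- A principal `U(1)`-bundle over a smooth space. -/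
structure U1Bundle (A : Type u) [TopologicalSpace A] [DiffeologicalSpace A] where
  Total : Type v
  [diffeology : DiffeologicalSpace Total]
  [action : MulAction Circle Total]
  proj : Total → A
  dSmooth_proj : DSmooth proj
  dSmooth_smul : DSmooth (fun x : Circle × Total => x.1 • x.2)
  proj_smul : ∀ (g : Circle) (e : Total), proj (g • e) = proj e
  exists_trivialization : ∀ a : A, ∃ U : Set A, IsOpen U ∧ a ∈ U ∧
    ∃ φ : {e : Total // proj e ∈ U} ≃ {x : A // x ∈ U} × Circle,
      DSmooth φ ∧ DSmooth φ.symm ∧ (∀ e, ((φ e).1 : A) = proj e) ∧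
      ∀ (g : Circle) (e e' : {e : Total // proj e ∈ U}), (e' : Total) = g • (e : Total) →
        φ e' = ((φ e).1, g * (φ e).2)

attribute [instance] U1Bundle.diffeology U1Bundle.action

variable {A : Type*} [TopologicalSpace A] [DiffeologicalSpace A]

/-- A connection on a principal `U(1)`-bundle: a (real-valued) 1-form on the total space whose
pullback along the action `U(1) × P → P` is the sum of the Maurer–Cartan form and of itself. This
says that it is invariant and takes the value 1 on the generating vector field. -/
def U1Bundle.IsConnection (P : U1Bundle A) (w : Form 1 P.Total) : Prop :=
  Form.pullback (fun x : Circle × P.Total => x.1 • x.2) P.dSmooth_smul w =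
    Form.pullback Prod.fst dSmooth_fst maurerCartan + Form.pullback Prod.snd dSmooth_snd w

variable {B ι : Type*} [DiffeologicalSpace B]

/-- For maps `f_i : B → A`, the fibre product over `B` of the pulled back bundles `f_i^*P`. -/
abbrev U1Bundle.Families (P : U1Bundle A) (f : ι → B → A) : Type _ :=
  {x : B × (ι → P.Total) // ∀ i, P.proj (x.2 i) = f i x.1}

/-- Sections of the `U(1)`-bundle `⨂_i (f_i^*P)^{ε_i}` over `B`, for signs `ε_i = ±1` (the power
`-1` stands for the dual). An element of the fibre of this tensor product over `b` is a class
`[p]·g` with `p_i ∈ P_{f_i(b)}`, `g ∈ U(1)`, where `[(g_i • p_i)_i] = [p] · ∏ g_i^{ε_i}`. A section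
is written `b ↦ [p] · s(b, p)`, with `s` a smooth `U(1)`-valued function on the fibre product of the
`f_i^*P` such that `s(b, (g_i • p_i)_i) = s(b, p) · ∏ g_i^{-ε_i}`. -/
structure TensorSection [Fintype ι] (P : U1Bundle A) (f : ι → B → A) (ε : ι → ℤ) where
  toFun : P.Families f → Circle
  smooth : DSmooth toFun
  equivariant : ∀ (x y : P.Families f) (g : ι → Circle), y.1.1 = x.1.1 →
    (∀ i, y.1.2 i = g i • x.1.2 i) → toFun y = toFun x * ∏ i, (g i) ^ (-(ε i))

/-- The value `s(b, p)`. -/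
def TensorSection.eval [Fintype ι] {P : U1Bundle A} {f : ι → B → A} {ε : ι → ℤ}
    (s : TensorSection P f ε) (b : B) (p : ι → P.Total) (hp : ∀ i, P.proj (p i) = f i b) : Circle :=
  s.toFun ⟨(b, p), hp⟩

/-- `s^*∇ = η`, where `s` is a section of `⨂_i (f_i^*P)^{ε_i}` over `B`, `∇` is the connection
induced by the connection `w` on `P`, and `η` is a 1-form on `B`. For the section `[p] · s(b, p)`
this means that the pullback of `η` to the fibre product of the `f_i^*P` is
`∑ ε_i p_i^*w + s^*(dθ)`. -/
def TensorSection.PullsBackTo [Fintype ι] {P : U1Bundle A} {f : ι → B → A} {ε : ι → ℤ}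
    (s : TensorSection P f ε) (w : Form 1 P.Total) (η : Form 1 B) : Prop :=
  Form.pullback (fun x : P.Families f => x.1.1) (dSmooth_fst.comp dSmooth_val) η =
    ∑ i, ε i • Form.pullback (fun x : P.Families f => x.1.2 i)
        ((dSmooth_apply i).comp (dSmooth_snd.comp dSmooth_val)) w +
      Form.pullback s.toFun s.smooth maurerCartan

/-- The signs of an alternating sum (or alternating tensor product). -/
def altSign {n : ℕ} (i : Fin n) : ℤ := (-1) ^ (i : ℕ)

/-- Let `D → C → A` be consecutive levels of a semisimplicial space, with face maps `dD` and `dC`,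
and let `s` be a section of `δP = d_0^*P ⊗ d_1^*P^* ⊗ ⋯` over `C`. This says that the induced
section `δ(s)` of `δ²P` is the canonical section. The factors of `δ²P` indexed by `(k+1, i)` and
`(i, k)`, for `i ≤ k`, are dual to each other, because `d_i d_{k+1} = d_k d_i`, and the canonical
section is the one represented by the families `(p_{ji})` having the same entry in both. -/
def TensorSection.DeltaIsCanonical {C D : Type*} [DiffeologicalSpace C] {n : ℕ} {P : U1Bundle A}
    {dC : Fin (n + 1) → C → A} (s : TensorSection P dC altSign) (dD : Fin (n + 2) → D → C) :
    Prop :=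
  ∀ (x : D) (p : Fin (n + 2) → Fin (n + 1) → P.Total)
    (hp : ∀ j i, P.proj (p j i) = dC i (dD j x)),
    (∀ i k : Fin (n + 1), i ≤ k → p k.succ i = p i.castSucc k) →
      ∏ j, (s.eval (dD j x) (p j) (hp j)) ^ altSign j = 1

/-- A bundle gerbe on `B` with respect to `π : Z → B`: a `U(1)`-bundle `E` on `Z^{[2]}` with a
section `m` of `δE` over `Z^{[3]}` such that `δ(m)` is the canonical section of `δ²E` over
`Z^{[4]}`. In terms of the multiplication, `e_{23} · e_{12} = e_{13}` iff
`m(e_{23}, e_{13}, e_{12}) = 1`. -/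
structure BundleGerbe {Z B : Type*} [TopologicalSpace Z] [DiffeologicalSpace Z] (π : Z → B) where
  bundle : U1Bundle.{_, v} (FibProd π 2)
  mul : TensorSection bundle (fun i : Fin 3 => FibProd.face π (k := 2) i) altSign
  assoc : mul.DeltaIsCanonical (fun j : Fin 4 => FibProd.face π (k := 3) j)

/-- A bundle gerbe connection: a connection `∇` with `m^*(δ∇) = 0`. -/
def BundleGerbe.IsConnection {Z B : Type*} [TopologicalSpace Z] [DiffeologicalSpace Z] {π : Z → B}
    (E : BundleGerbe π) (w : Form 1 E.bundle.Total) : Prop :=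
  E.bundle.IsConnection w ∧ E.mul.PullsBackTo w 0

/-- A curving for a bundle gerbe connection: a 2-form `β` on `Z` for which `δβ` is the curvature
of the connection. -/
def BundleGerbe.IsCurving {Z B : Type*} [TopologicalSpace Z] [DiffeologicalSpace Z] {π : Z → B}
    (E : BundleGerbe π) (w : Form 1 E.bundle.Total) (β : Form 2 Z) : Prop :=
  Form.pullback E.bundle.proj E.bundle.dSmooth_proj (delta π β) = Form.d w

end Bundles

/-! ### Simplicial submersions -/

section Simplicial

universe u v w

/-- A surjective submersion `Y → X` of manifolds, and a 3-truncated simplicial manifold `Z_•` with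
a surjective submersion `Z_• → Y^{[• + 1]}` of truncated simplicial manifolds. Only `Z n` with
`n ≤ 3` matters. -/
structure SimplicialSubmersion (X : Type u) [TopologicalSpace X] [DiffeologicalSpace X] where
  Y : Type v
  [topY : TopologicalSpace Y]
  [diffY : DiffeologicalSpace Y]
  manifoldY : IsSmoothManifold Y
  π : Y → X
  submersion : IsSurjSubmersion π
  Z : ℕ → Type w
  [topZ : ∀ n, TopologicalSpace (Z n)]
  [diffZ : ∀ n, DiffeologicalSpace (Z n)]
  manifoldZ : ∀ n ≤ 3, IsSmoothManifold (Z n)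
  map : ∀ {m n : ℕ}, m ≤ 3 → n ≤ 3 → (Fin (m + 1) →o Fin (n + 1)) → Z n → Z m
  dSmooth_map : ∀ {m n : ℕ} (hm : m ≤ 3) (hn : n ≤ 3) (f : Fin (m + 1) →o Fin (n + 1)),
    DSmooth (map hm hn f)
  map_id : ∀ {n : ℕ} (hn : n ≤ 3) (z : Z n), map hn hn OrderHom.id z = z
  map_comp : ∀ {l m n : ℕ} (hl : l ≤ 3) (hm : m ≤ 3) (hn : n ≤ 3)
    (f : Fin (l + 1) →o Fin (m + 1)) (g : Fin (m + 1) →o Fin (n + 1)) (z : Z n),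
    map hl hn (g.comp f) z = map hl hm f (map hm hn g z)
  πZ : ∀ n, Z n → FibProd π (n + 1)
  submersionZ : ∀ n ≤ 3, IsSurjSubmersion (πZ n)
  πZ_map : ∀ {m n : ℕ} (hm : m ≤ 3) (hn : n ≤ 3) (f : Fin (m + 1) →o Fin (n + 1)) (z : Z n)
    (i : Fin (m + 1)), (πZ m (map hm hn f z)).1 i = (πZ n z).1 (f i)

attribute [instance] SimplicialSubmersion.topY SimplicialSubmersion.diffY
  SimplicialSubmersion.topZ SimplicialSubmersion.diffZ

namespace SimplicialSubmersion

variable {X : Type u} [TopologicalSpace X] [DiffeologicalSpace X]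
  (S : SimplicialSubmersion.{u, v, w} X)

/-- The projection `Z_0 → Y`. -/
def π₀ (z : S.Z 0) : S.Y := (S.πZ 0 z).1 0

lemma dSmooth_π₀ : DSmooth S.π₀ :=
  (dSmooth_apply (0 : Fin 1)).comp (dSmooth_val.comp (S.submersionZ 0 (by simp)).smooth)

/-- `Z_n^{[k]}`, the `k`-fold fibre product of `Z_n` over `Y^{[n+1]}`. -/
abbrev Fib (n k : ℕ) : Type _ := FibProd (S.πZ n) k

/-- The vertical face maps `d_i : Z_n^{[k+1]} → Z_n^{[k]}`. -/
def vface (n k : ℕ) (i : Fin (k + 1)) : S.Fib n (k + 1) → S.Fib n k := FibProd.face (S.πZ n) i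

/-- The simplicial face maps `d_i : Z_{n+1} → Z_n`. -/
def face (n : ℕ) (hn : n + 1 ≤ 3) (i : Fin (n + 2)) : S.Z (n + 1) → S.Z n :=
  S.map (by omega) hn (Fin.succAboveOrderEmb i).toOrderHom

/-- The horizontal face maps `d_i^{[k]} : Z_{n+1}^{[k]} → Z_n^{[k]}`. -/
def hface (n k : ℕ) (hn : n + 1 ≤ 3) (i : Fin (n + 2)) (z : S.Fib (n + 1) k) : S.Fib n k :=
  ⟨fun l => S.face n hn i (z.1 l), fun l l' => by
    apply Subtype.ext
    funext j
    rw [face, S.πZ_map, S.πZ_map, z.2 l l']⟩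

/-- `δ_h : Ω^k(Z_n) → Ω^k(Z_{n+1})`, the alternating sum of the pullbacks along the face maps. -/
def deltaH (n : ℕ) (hn : n + 1 ≤ 3) {k : ℕ} : Form k (S.Z n) →ₗ[ℝ] Form k (S.Z (n + 1)) :=
  ∑ i : Fin (n + 2), (altSign i : ℝ) •
    Form.pullback (S.face n hn i) (S.dSmooth_map _ hn _)

end SimplicialSubmersion

end Simplicial

/-! ### Rigid bundle 2-gerbes, trivialisations and connective structures -/

section Rigid

universe u v w x y

/-- A rigid bundle 2-gerbe on `X`. -/
structure RigidBundleTwoGerbe (X : Type u) [TopologicalSpace X] [DiffeologicalSpace X]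
    extends SimplicialSubmersion.{u, v, w} X where
  /-- the bundle gerbe `(E, Z_1)` on `Y^{[2]}` -/
  E : BundleGerbe.{x} (toSimplicialSubmersion.πZ 1)
  /-- the bundle 2-gerbe multiplication, a section of `δ_h E` over `Z_2^{[2]}` -/
  M : TensorSection E.bundle
    (fun i : Fin 3 => toSimplicialSubmersion.hface 1 2 (by norm_num) i) altSign
  /-- `δ_v(M) = δ_h(m)` as sections of `δ_v δ_h E = δ_h δ_v E` over `Z_2^{[3]}` -/
  M_compat : ∀ (z : toSimplicialSubmersion.Fib 2 3) (p : Fin 3 → Fin 3 → E.bundle.Total)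
    (h₁ : ∀ i j, E.bundle.proj (p i j) = toSimplicialSubmersion.hface 1 2 (by norm_num) j
      (toSimplicialSubmersion.vface 2 2 i z))
    (h₂ : ∀ j i, E.bundle.proj (p i j) = toSimplicialSubmersion.vface 1 2 i
      (toSimplicialSubmersion.hface 1 3 (by norm_num) j z)),
    ∏ i, (M.eval (toSimplicialSubmersion.vface 2 2 i z) (fun j => p i j) (h₁ i)) ^ altSign i =
      ∏ j, (E.mul.eval (toSimplicialSubmersion.hface 1 3 (by norm_num) j z) (fun i => p i j)
        (h₂ j)) ^ altSign j
  /-- `δ_h(M) = 1` as a section of the canonically trivial bundle `δ_h² E` over `Z_3^{[2]}` -/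
  M_assoc : M.DeltaIsCanonical
    (fun j : Fin 4 => toSimplicialSubmersion.hface 2 2 (by norm_num) j)

variable {X : Type u} [TopologicalSpace X] [DiffeologicalSpace X]

/-- A trivialisation `(F, t)` of a rigid bundle 2-gerbe. -/
structure RigidTrivialisation (G : RigidBundleTwoGerbe.{u, v, w, x} X) where
  /-- the bundle gerbe `(F, Z_0)` on `Y = Y^{[1]}` -/
  F : BundleGerbe.{y} (G.πZ 0)
  /-- The map `t : E → δ_h F` over `Z_1^{[2]}`, that is, a section over `E` of the pullback of
  `δ_h F`: the element `t(e)` is `[f] · t(e, f)` with `f = (f_0, f_1)`. -/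
  t : TensorSection F.bundle
    (fun (i : Fin 2) (e : G.E.bundle.Total) => G.hface 0 2 (by norm_num) i (G.E.bundle.proj e))
    altSign
  /-- `t` is an isomorphism of `U(1)`-bundles, that is, it is `U(1)`-equivariant -/
  t_equivariant : ∀ (g : Circle) (e : G.E.bundle.Total) (f : Fin 2 → F.bundle.Total)
    (h : ∀ i, F.bundle.proj (f i) = G.hface 0 2 (by norm_num) i (G.E.bundle.proj e))
    (h' : ∀ i, F.bundle.proj (f i) = G.hface 0 2 (by norm_num) i (G.E.bundle.proj (g • e))),
    t.eval (g • e) f h' = g * t.eval e f h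
  /-- `t` is compatible with the multiplications: it maps the section `m_E` of `δ_v E` to the
  section `δ_h(m_F)` of `δ_h δ_v F = δ_v δ_h F` over `Z_1^{[3]}` -/
  t_mul : ∀ (z : G.Fib 1 3) (e : Fin 3 → G.E.bundle.Total) (f : Fin 3 → Fin 2 → F.bundle.Total)
    (he : ∀ i, G.E.bundle.proj (e i) = G.vface 1 2 i z)
    (h₁ : ∀ i j, F.bundle.proj (f i j) = G.hface 0 2 (by norm_num) j (G.E.bundle.proj (e i)))
    (h₂ : ∀ j i, F.bundle.proj (f i j) = G.vface 0 2 i (G.hface 0 3 (by norm_num) j z)),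
    G.E.mul.eval z e he * ∏ i, (t.eval (e i) (f i) (h₁ i)) ^ altSign i =
      ∏ j, (F.mul.eval (G.hface 0 3 (by norm_num) j z) (fun i => f i j) (h₂ j)) ^ altSign j
  /-- the section `δ_h(t) ∘ M` of `δ_h² F` over `Z_2^{[2]}` is the canonical section -/
  t_M : ∀ (z : G.Fib 2 2) (e : Fin 3 → G.E.bundle.Total) (f : Fin 3 → Fin 2 → F.bundle.Total)
    (he : ∀ i, G.E.bundle.proj (e i) = G.hface 1 2 (by norm_num) i z)
    (h : ∀ i j, F.bundle.proj (f i j) = G.hface 0 2 (by norm_num) j (G.E.bundle.proj (e i))),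
    (∀ j k : Fin 2, j ≤ k → f k.succ j = f j.castSucc k) →
      G.M.eval z e he * ∏ i, (t.eval (e i) (f i) (h i)) ^ altSign i = 1

/-- A connective structure `(∇_E, β, λ)` on a rigid bundle 2-gerbe. -/
structure ConnectiveStructure (G : RigidBundleTwoGerbe.{u, v, w, x} X) where
  connE : Form 1 G.E.bundle.Total
  isConnection : G.E.IsConnection connE
  β : Form 2 (G.Z 1)
  isCurving : G.E.IsCurving connE β
  lam : Form 3 G.Y
  /-- `π^* δ_h λ = dβ` -/
  isTwoCurving : Form.pullback (G.πZ 1) (G.submersionZ 1 (by norm_num)).smooth (delta G.π lam) =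
    Form.d β

/-- A rigid connective structure `(∇_E, β, λ, α)` on a rigid bundle 2-gerbe. -/
structure RigidConnectiveStructure (G : RigidBundleTwoGerbe.{u, v, w, x} X)
    extends ConnectiveStructure G where
  α : Form 1 (G.Z 2)
  /-- `M^*(δ_h ∇_E) = δ_v α` -/
  delta_α : G.M.PullsBackTo connE (delta (G.πZ 2) α)
  /-- `dα = δ_h β` -/
  d_α : Form.d α = G.deltaH 1 (by norm_num) β
  /-- `δ_h α = 0` -/
  deltaH_α : G.deltaH 2 (by norm_num) α = 0

/-- A trivialisation connective structure `(∇_F, a, b)`. -/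
structure TrivialisationConnectiveStructure {G : RigidBundleTwoGerbe.{u, v, w, x} X}
    (T : RigidTrivialisation.{u, v, w, x, y} G) (C : ConnectiveStructure G) where
  connF : Form 1 T.F.bundle.Total
  isConnection : T.F.IsConnection connF
  b : Form 2 (G.Z 0)
  isCurving : T.F.IsCurving connF b
  a : Form 1 (G.Z 1)
  /-- `π^* δ_v a = ∇_E - t^* δ_h ∇_F` on `E` -/
  conn_eq : ∃ η : Form 1 G.E.bundle.Total, T.t.PullsBackTo connF η ∧
    Form.pullback G.E.bundle.proj G.E.bundle.dSmooth_proj (delta (G.πZ 1) a) = C.connE - η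
  /-- `da = β - δ_h b` -/
  d_a : Form.d a = C.β - G.deltaH 0 (by norm_num) b

end Rigid

end RigidGerbe

end

open RigidGerbe

noncomputable section

namespace RigidGerbe

open Filter Topology


/-! ### Localisation of plots -/

section Localisation

/-! Two facts about a map with smooth local sections carry the proof. By
`IsSubduction.exists_pullback_eq` and `IsSubduction.pullback_injective`, a form upstairs whose
`delta` vanishes is the pullback of a unique form on the base. By `FibProd.exists_coboundary_eq`,
the complex of forms on the fibre powers is exact: over a small open set of the base, inserting a
local section as an extra factor is a contracting homotopy, and a partition of unity on the base
glues the local primitives.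

For existence, take any gerbe connection `∇_F` and curving `b` on `F`
(`BundleGerbe.exists_isCurving`). The form `∇_E - t^*δ_h∇_F` lives on `Z_1^{[2]}` and is a vertical
cocycle because `t` respects the multiplications (`RigidTrivialisation.coboundary_eq_zero`), so it
is `δ_v a`. Two corrections remain. (1) Since `δ_h(t) ∘ M` is canonical, `δ_h a - α` is vertically
closed (`RigidTrivialisation.delta_deltaH_sub_eq_zero`) and descends to `A` on `Y^{[3]}`. From `δ_h
α = 0` follows `δA = 0`, so `A = δA'`, and `a - π^*A'` satisfies `δ_h a = α` exactly. (2) Comparing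
curvatures, `β - δ_h b - da` is vertically closed and descends to `Q` on `Y^{[2]}`. Now `dα = δ_h β`
and `δ_h a = α` give `δQ = 0`, so `Q = δb'`, and adding `π^*b'` to `b` yields `da = β - δ_h b`. Both
corrections are pulled back from fibre powers of `Y`, so they do not disturb the vertical equations
already achieved.

The curvature statements are descent only: `dλ`, `db` and `λ - h` have vanishing `delta`, and `dR =
H` because `h` is closed. -/

/-- Every neighbourhood of a point of `ℝⁿ` contains the range of a smooth self-map of `ℝⁿ` which is
the identity near the point. -/
lemma exists_contDiff_eventuallyEq_id {n : ℕ} {t : Euc n} {U : Set (Euc n)} (hU : U ∈ 𝓝 t) :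
    ∃ f : Euc n → Euc n, ContDiff ℝ ∞ f ∧ (∀ s, f s ∈ U) ∧ f =ᶠ[𝓝 t] id := by
  obtain ⟨ε, hε, hεU⟩ := Metric.mem_nhds_iff.1 hU
  let χ : ContDiffBump t := ⟨ε / 2, ε, by positivity, by linarith⟩
  -- Points are scaled towards `t` by the bump function: they are fixed where `χ = 1`, sent to `t`
  -- where `χ = 0`, and never leave the ball since `0 ≤ χ ≤ 1`.
  refine ⟨fun s => t + χ s • (s - t), ?_, fun s => hεU ?_, ?_⟩
  · exact contDiff_const.add (χ.contDiff.smul (contDiff_id.sub contDiff_const))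
  · rw [Metric.mem_ball, dist_eq_norm, add_sub_cancel_left, norm_smul]
    by_cases hs : ε ≤ dist s t
    · rw [χ.zero_of_le_dist hs]
      simpa using hε
    · rw [Real.norm_of_nonneg χ.nonneg, ← dist_eq_norm]
      calc χ s * dist s t ≤ 1 * dist s t := by
            gcongr
            exact χ.le_one
        _ < ε := by linarith
  · filter_upwards [χ.eventuallyEq_one] with s hs
    simp [hs]

variable {X : Type*} [DiffeologicalSpace X]

/-- A plot which maps a point into an open set factors near the point through the open set. -/
lemma IsPlot.exists_lift_subtype {n : ℕ} {p : Euc n → X} (hp : IsPlot p) {P : X → Prop}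
    {t : Euc n} (h : ∀ᶠ s in 𝓝 t, P (p s)) :
    ∃ q : Euc n → {x // P x}, IsPlot q ∧ Subtype.val ∘ q =ᶠ[𝓝 t] p := by
  obtain ⟨f, hf, hfU, hft⟩ := exists_contDiff_eventuallyEq_id h
  refine ⟨fun s => ⟨p (f s), hfU s⟩, isPlot_reparam hp hf, ?_⟩
  filter_upwards [hft] with s hs
  simp [hs]

/-- A map which agrees locally with plots is a plot. -/
lemma isPlot_of_locally {n : ℕ} {p : Euc n → X}
    (h : ∀ t, ∃ q : Euc n → X, IsPlot q ∧ q =ᶠ[𝓝 t] p) : IsPlot p := by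
  refine DiffeologicalSpace.locality fun t => ?_
  obtain ⟨q, hq, hqt⟩ := h t
  obtain ⟨u, hu, huo, htu⟩ := eventually_nhds_iff.1 hqt
  refine ⟨u, huo, htu, fun {m g} hgu hg => ?_⟩
  have : p ∘ g = q ∘ g := funext fun s => (hu _ (hgu s)).symm
  rw [this]
  exact isPlot_reparam hq hg

end Localisation

/-! ### Evaluation of forms on plots -/

section Evaluation

variable {X Y : Type*} [DiffeologicalSpace X] [DiffeologicalSpace Y] {k n m : ℕ}

/-- The value at `t` of the pullback of the form `η` along the plot `p`. -/
def Form.eval (η : Form k X) (p : Euc n → X) (hp : IsPlot p) (t : Euc n) :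
    Euc n [⋀^Fin k]→L[ℝ] ℝ := η.1 n ⟨p, hp⟩ t

lemma Form.ext_eval {a b : Form k X}
    (h : ∀ (n : ℕ) (p : Euc n → X) (hp : IsPlot p) (t : Euc n), a.eval p hp t = b.eval p hp t) :
    a = b := Form.ext fun n p t => h n p.1 p.2 t

lemma Form.contDiff_eval (η : Form k X) {p : Euc n → X} (hp : IsPlot p) :
    ContDiff ℝ ∞ (η.eval p hp) := η.2.1 n _

lemma Form.eval_comp (η : Form k X) {p : Euc n → X} (hp : IsPlot p) {f : Euc m → Euc n}
    (hf : ContDiff ℝ ∞ f) (h : IsPlot (p ∘ f)) (t : Euc m) :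
    η.eval (p ∘ f) h t = (η.eval p hp (f t)).compContinuousLinearMap (fderiv ℝ f t) :=
  η.2.2 m n ⟨p, hp⟩ f hf t

@[simp] lemma Form.eval_zero (p : Euc n → X) (hp : IsPlot p) (t : Euc n) :
    (0 : Form k X).eval p hp t = 0 := rfl

@[simp] lemma Form.eval_add (a b : Form k X) (p : Euc n → X) (hp : IsPlot p) (t : Euc n) :
    (a + b).eval p hp t = a.eval p hp t + b.eval p hp t := rfl

@[simp] lemma Form.eval_sub (a b : Form k X) (p : Euc n → X) (hp : IsPlot p) (t : Euc n) :
    (a - b).eval p hp t = a.eval p hp t - b.eval p hp t := rfl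

@[simp] lemma Form.eval_smul (c : ℝ) (a : Form k X) (p : Euc n → X) (hp : IsPlot p) (t : Euc n) :
    (c • a).eval p hp t = c • a.eval p hp t := rfl

/-- Evaluation on a plot at a point, as a homomorphism. -/
def Form.evalHom (p : Euc n → X) (hp : IsPlot p) (t : Euc n) :
    Form k X →+ Euc n [⋀^Fin k]→L[ℝ] ℝ where
  toFun η := η.eval p hp t
  map_zero' := rfl
  map_add' _ _ := rfl

@[simp] lemma Form.eval_zsmul (c : ℤ) (a : Form k X) (p : Euc n → X) (hp : IsPlot p) (t : Euc n) :
    (c • a).eval p hp t = c • a.eval p hp t := map_zsmul (Form.evalHom p hp t) c a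

@[simp] lemma Form.eval_sum {ι : Type*} (s : Finset ι) (a : ι → Form k X) (p : Euc n → X)
    (hp : IsPlot p) (t : Euc n) :
    (∑ i ∈ s, a i).eval p hp t = ∑ i ∈ s, (a i).eval p hp t :=
  map_sum (Form.evalHom p hp t) a s

@[simp] lemma Form.eval_pullback (f : X → Y) (hf : DSmooth f) (η : Form k Y) (p : Euc n → X)
    (hp : IsPlot p) (t : Euc n) :
    (Form.pullback f hf η).eval p hp t = η.eval (f ∘ p) (hf n p hp) t := rfl

lemma Form.eval_d (η : Form k X) (p : Euc n → X) (hp : IsPlot p) (t : Euc n) :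
    (Form.d η).eval p hp t = extDeriv (η.eval p hp) t := rfl

/-- The value of a form on a plot depends only on the germ of the plot. -/
lemma Form.eval_congr (η : Form k X) {p q : Euc n → X} (hp : IsPlot p) (hq : IsPlot q)
    {t : Euc n} (h : p =ᶠ[𝓝 t] q) : η.eval p hp t = η.eval q hq t := by
  obtain ⟨f, hf, hfU, hft⟩ := exists_contDiff_eventuallyEq_id h
  have hpq : p ∘ f = q ∘ f := funext hfU
  -- The derivative of `f` at `t` is the identity, so precomposing with `f` does not change the
  -- value at `t`, whereas `p ∘ f = q ∘ f` holds everywhere.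
  have key : ∀ {r : Euc n → X} (hr : IsPlot r) (h : IsPlot (r ∘ f)),
      η.eval (r ∘ f) h t = η.eval r hr t := by
    intro r hr h
    rw [η.eval_comp hr hf, hft.fderiv_eq, hft.eq_of_nhds, fderiv_id]
    ext v
    simp
  rw [← key hp (isPlot_reparam hp hf), ← key hq (isPlot_reparam hq hf)]
  congr 1

lemma Form.eval_congr' (η : Form k X) {p q : Euc n → X} (hp : IsPlot p) (hq : IsPlot q)
    (h : p = q) (t : Euc n) : η.eval p hp t = η.eval q hq t := by
  subst h; rfl

lemma Form.d_d (η : Form k X) : Form.d (Form.d η) = 0 := by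
  refine Form.ext_eval fun n p hp t => ?_
  exact congrFun (extDeriv_extDeriv (r := ∞) (η.contDiff_eval hp) (by
    rw [minSmoothness_of_isRCLikeNormedField]
    exact WithTop.coe_le_coe.2 le_top)) t

lemma Form.d_pullback (f : X → Y) (hf : DSmooth f) (η : Form k Y) :
    Form.d (Form.pullback f hf η) = Form.pullback f hf (Form.d η) := rfl

end Evaluation

/-! ### Descent of forms -/

section Descent

variable {M X : Type*} [DiffeologicalSpace M] {k n m : ℕ}

/-- The value at `t` of the form `η` on a local lift of `p` through `f` at `t`. -/
def Form.lift (f : M → X) (η : Form k M) (p : Euc n → X) (t : Euc n) : Euc n [⋀^Fin k]→L[ℝ] ℝ :=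
  open Classical in
  -- The value `0` in the absence of a lift is harmless: along a subduction lifts always exist, and
  -- in `SmoothPartition.glue` the weight vanishes at points with no lift.
  if h : ∃ q : Euc n → M, IsPlot q ∧ f ∘ q =ᶠ[𝓝 t] p then
    η.eval h.choose h.choose_spec.1 t else 0

/-- A form on `M` is basic for `f : M → X` if its value on a plot depends only on the projection of
the plot to `X`. -/
def Form.IsBasic (f : M → X) (η : Form k M) : Prop :=
  ∀ (n : ℕ) (q q' : Euc n → M) (hq : IsPlot q) (hq' : IsPlot q'), f ∘ q = f ∘ q' →
    ∀ t, η.eval q hq t = η.eval q' hq' t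

/-- Precomposing both plots with a smooth self-map that is the identity near `t` and lands where the
projections agree turns equality of germs into the global equality that `IsBasic` needs. -/
lemma Form.IsBasic.eval_congr {f : M → X} {η : Form k M} (h : η.IsBasic f) {q q' : Euc n → M}
    (hq : IsPlot q) (hq' : IsPlot q') {t : Euc n} (hqq' : f ∘ q =ᶠ[𝓝 t] f ∘ q') :
    η.eval q hq t = η.eval q' hq' t := by
  obtain ⟨g, hg, hgU, hgt⟩ := exists_contDiff_eventuallyEq_id hqq'
  have e : ∀ r : Euc n → M, r ∘ g =ᶠ[𝓝 t] r := fun r => by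
    filter_upwards [hgt] with s hs
    simp [hs]
  rw [← η.eval_congr (isPlot_reparam hq hg) hq (e q),
    ← η.eval_congr (isPlot_reparam hq' hg) hq' (e q')]
  exact h n _ _ _ _ (funext hgU) t

/-- Used with `Subtype.val`: a form given only on an open part of `X` can be evaluated through
`Form.lift` on plots of `X`. -/
lemma Form.isBasic_of_injective {f : M → X} (hf : Function.Injective f) (η : Form k M) :
    η.IsBasic f := fun _ _ _ hq hq' h t =>
  η.eval_congr' hq hq' (hf.comp_left h) t

lemma Form.IsBasic.lift_eq {f : M → X} {η : Form k M} (h : η.IsBasic f) {p : Euc n → X}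
    {q : Euc n → M} (hq : IsPlot q) {t : Euc n} (hqp : f ∘ q =ᶠ[𝓝 t] p) :
    η.lift f p t = η.eval q hq t := by
  have h' : ∃ q : Euc n → M, IsPlot q ∧ f ∘ q =ᶠ[𝓝 t] p := ⟨q, hq, hqp⟩
  rw [Form.lift, dif_pos h']
  exact h.eval_congr _ _ (h'.choose_spec.2.trans hqp.symm)

/-- A single plot lifting `p` near `t` is also a lift at all nearby points, so the pointwise choices
in `Form.lift` agree there with one smooth function. -/
lemma Form.IsBasic.contDiffAt_lift {f : M → X} {η : Form k M} (h : η.IsBasic f) {p : Euc n → X}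
    {t : Euc n} (hp : ∃ q : Euc n → M, IsPlot q ∧ f ∘ q =ᶠ[𝓝 t] p) :
    ContDiffAt ℝ ∞ (η.lift f p) t := by
  obtain ⟨q, hq, hqt⟩ := hp
  refine (η.contDiff_eval hq).contDiffAt.congr_of_eventuallyEq ?_
  filter_upwards [eventually_eventually_nhds.2 hqt] with s hs
  exact h.lift_eq hq hs

lemma Form.IsBasic.lift_comp {f : M → X} {η : Form k M} (h : η.IsBasic f) {p : Euc n → X}
    {g : Euc m → Euc n} (hg : ContDiff ℝ ∞ g) {t : Euc m}
    (hp : ∃ q : Euc n → M, IsPlot q ∧ f ∘ q =ᶠ[𝓝 (g t)] p) :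
    η.lift f (p ∘ g) t = (η.lift f p (g t)).compContinuousLinearMap (fderiv ℝ g t) := by
  obtain ⟨q, hq, hqt⟩ := hp
  rw [h.lift_eq hq hqt, ← η.eval_comp hq hg (isPlot_reparam hq hg)]
  exact h.lift_eq _ (hqt.comp_tendsto hg.continuous.continuousAt)

/-- Two plots with the same projection form a plot of the fibre square, and `delta π η` on it is the
difference of the two values. -/
lemma isBasic_of_delta_eq_zero {π : M → X} {η : Form k M} (h : delta π η = 0) :
    η.IsBasic π := by
  intro n q q' hq hq' hqq' t
  let r : Euc n → FibProd π 2 := fun s => ⟨![q s, q' s], by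
    have := congrFun hqq' s
    simp only [Function.comp_apply] at this
    simp [Fin.forall_fin_two, this]⟩
  have hr : IsPlot r := by
    intro i
    fin_cases i
    · exact hq
    · exact hq'
  have := congrArg (fun ζ => Form.eval ζ r hr t) h
  simp only [delta, LinearMap.sub_apply, Form.eval_sub, Form.eval_pullback, Form.eval_zero] at this
  exact (sub_eq_zero.1 this).symm

variable [DiffeologicalSpace X]

/-- A subduction: a smooth map through which every plot lifts locally. -/
structure IsSubduction (f : M → X) : Prop where
  smooth : DSmooth f
  exists_lift : ∀ (n : ℕ) (p : Euc n → X), IsPlot p → ∀ t,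
    ∃ q : Euc n → M, IsPlot q ∧ f ∘ q =ᶠ[𝓝 t] p

lemma IsSubduction.pullback_injective {f : M → X} (hf : IsSubduction f) :
    Function.Injective (Form.pullback (k := k) f hf.smooth) := by
  intro a b hab
  refine Form.ext_eval fun n p hp t => ?_
  obtain ⟨q, hq, hqt⟩ := hf.exists_lift n p hp t
  rw [← a.eval_congr (hf.smooth n q hq) hp hqt, ← b.eval_congr (hf.smooth n q hq) hp hqt,
    ← Form.eval_pullback f hf.smooth a q hq, hab, Form.eval_pullback]

/-- Basic forms descend along subductions. -/
lemma IsSubduction.exists_pullback_eq {f : M → X} (hf : IsSubduction f) {η : Form k M}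
    (h : η.IsBasic f) : ∃ ζ : Form k X, Form.pullback f hf.smooth ζ = η := by
  refine ⟨⟨fun n p => η.lift f p.1, fun n p => ?_, fun m n p g hg t => ?_⟩, ?_⟩
  · exact contDiff_iff_contDiffAt.2 fun t => h.contDiffAt_lift (hf.exists_lift n p.1 p.2 t)
  · exact h.lift_comp hg (hf.exists_lift n p.1 p.2 (g t))
  · refine Form.ext_eval fun n q hq t => ?_
    exact h.lift_eq hq (EventuallyEq.refl _ _)

lemma delta_pullback_eq_zero {π : M → X} (hπ : DSmooth π) (ζ : Form k X) :
    delta π (Form.pullback π hπ ζ) = 0 := by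
  refine Form.ext_eval fun n r hr t => ?_
  simp only [delta, LinearMap.sub_apply, Form.eval_sub, Form.eval_pullback, Form.eval_zero]
  exact sub_eq_zero.2 (ζ.eval_congr' _ _ (funext fun s => (r s).2 1 0) t)

end Descent


/-! ### Smoothly regular spaces and partitions of unity -/

section Regular

/-- Second countable smooth spaces with continuous plots and enough continuous smooth bump
functions. -/
structure IsSmoothlyRegular (A : Type*) [TopologicalSpace A] [DiffeologicalSpace A] : Prop where
  secondCountable : SecondCountableTopology A
  continuous_plot : ∀ (n : ℕ) (p : Euc n → A), IsPlot p → Continuous p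
  exists_bump : ∀ (m : A) (U : Set A), IsOpen U → m ∈ U →
    ∃ f : A → ℝ, DSmooth f ∧ Continuous f ∧ f m = 1 ∧ (∀ x, 0 ≤ f x) ∧ ∀ x ∉ U, f x = 0

variable {A : Type*} [TopologicalSpace A] [DiffeologicalSpace A]

lemma continuous_plot_of_compatible [IsDTopologyCompatible A] {n : ℕ} {p : Euc n → A}
    (hp : IsPlot p) : Continuous p := by
  rw [← IsDTopologyCompatible.dTop_eq A]
  exact hp.continuous

lemma IsSmoothManifold.isSmoothlyRegular (h : IsSmoothManifold A) : IsSmoothlyRegular A := by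
  have := h.dTopology
  refine ⟨h.secondCountable, fun n p hp => continuous_plot_of_compatible hp, fun m U hU hm => ?_⟩
  obtain ⟨f, hf, h1, h2, h3⟩ := h.exists_bump m U hU hm
  exact ⟨f, hf, hf.continuous', h1, h2, h3⟩

/-- Smooth regularity passes to subspaces and finite powers, hence to fibre powers, without any
charts on them; it is all that partitions of unity need. -/
lemma IsSmoothlyRegular.subtype (h : IsSmoothlyRegular A) (P : A → Prop) :
    IsSmoothlyRegular {x : A // P x} := by
  have := h.secondCountable
  refine ⟨Topology.IsEmbedding.subtypeVal.isInducing.secondCountableTopology,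
    fun n p hp => ?_, fun m U hU hm => ?_⟩
  · exact continuous_induced_rng.2 (h.continuous_plot n _ hp)
  · obtain ⟨V, hV, rfl⟩ := isOpen_induced_iff.1 hU
    obtain ⟨f, hf, hc, h1, h2, h3⟩ := h.exists_bump m V hV hm
    exact ⟨f ∘ Subtype.val, hf.comp dSmooth_val, hc.comp continuous_subtype_val, h1,
      fun x => h2 x, fun x hx => h3 x hx⟩

lemma IsSmoothlyRegular.pi (h : IsSmoothlyRegular A) (ι : Type*) [Fintype ι] :
    IsSmoothlyRegular (ι → A) := by
  have := h.secondCountable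
  refine ⟨inferInstance, fun n p hp => continuous_pi fun i => h.continuous_plot n _ (hp i),
    fun m U hU hm => ?_⟩
  obtain ⟨u, hu, huU⟩ := isOpen_pi_iff'.1 hU m hm
  choose f hf hc h1 h2 h3 using fun i => h.exists_bump (m i) (u i) (hu i).1 (hu i).2
  refine ⟨fun x => ∏ i, f i (x i), fun n p hp => ?_, ?_, by simp [h1],
    fun x => Finset.prod_nonneg fun i _ => h2 i _, fun x hx => ?_⟩
  · exact ContDiff.isPlot (contDiff_prod fun i _ => (hf i n _ (hp i)).contDiff)
  · exact continuous_finsetProd _ fun i _ => (hc i).comp (continuous_apply i)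
  · have : ∃ i, x i ∉ u i := by
      by_contra hcon
      push Not at hcon
      exact hx (huU fun i _ => hcon i)
    obtain ⟨i, hi⟩ := this
    exact Finset.prod_eq_zero (Finset.mem_univ i) (h3 i _ hi)

/-- A smooth partition of unity subordinate to the family `U` of subsets. -/
structure SmoothPartition {ι : Type*} (U : ι → Set A) where
  toFun : ι → A → ℝ
  smooth : ∀ i, DSmooth (toFun i)
  locallyFinite : ∀ b, ∃ s : Finset ι, ∀ᶠ x in 𝓝 b, ∀ i ∉ s, toFun i x = 0
  subordinate : ∀ i, ∀ b ∉ U i, ∀ᶠ x in 𝓝 b, toFun i x = 0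
  finsum_eq_one : ∀ b, ∑ᶠ i, toFun i b = 1

lemma finsum_eq_sum_of_forall_notMem {ι V : Type*} [AddCommMonoid V] {g : ι → V} {s : Finset ι}
    (h : ∀ i ∉ s, g i = 0) : ∑ᶠ i, g i = ∑ i ∈ s, g i :=
  finsum_eq_sum_of_support_subset g fun i hi => by
    by_contra his
    exact hi (h i his)

lemma contDiffAt_finsum {ι E V : Type*} [NormedAddCommGroup E] [NormedSpace ℝ E]
    [NormedAddCommGroup V] [NormedSpace ℝ V] {g : ι → E → V} {t : E} {s : Finset ι}
    (h : ∀ᶠ x in 𝓝 t, ∀ i ∉ s, g i x = 0) (hg : ∀ i, ContDiffAt ℝ ∞ (g i) t) :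
    ContDiffAt ℝ ∞ (fun x => ∑ᶠ i, g i x) t := by
  refine (ContDiffAt.sum (s := s) fun i _ => hg i).congr_of_eventuallyEq ?_
  filter_upwards [h] with x hx
  exact finsum_eq_sum_of_forall_notMem hx

/-- Normalisation of a locally finite family of nonnegative functions. -/
lemma exists_smoothPartition_of_pos (hA : IsSmoothlyRegular A) {ι : Type*} {U : ι → Set A}
    (g : ι → A → ℝ) (hg : ∀ i, DSmooth (g i)) (h0 : ∀ i x, 0 ≤ g i x)
    (hlf : ∀ b, ∃ s : Finset ι, ∀ᶠ x in 𝓝 b, ∀ i ∉ s, g i x = 0)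
    (hsub : ∀ i, ∀ b ∉ U i, ∀ᶠ x in 𝓝 b, g i x = 0) (hpos : ∀ b, ∃ i, 0 < g i b) :
    Nonempty (SmoothPartition U) := by
  have hsum : ∀ b, 0 < ∑ᶠ i, g i b := by
    intro b
    obtain ⟨s, hs⟩ := hlf b
    obtain ⟨i, hi⟩ := hpos b
    rw [finsum_eq_sum_of_forall_notMem hs.self_of_nhds]
    refine Finset.sum_pos' (fun j _ => h0 j b) ⟨i, ?_, hi⟩
    by_contra his
    exact hi.ne' (hs.self_of_nhds i his)
  refine ⟨⟨fun i x => g i x / ∑ᶠ j, g j x, fun i n p hp => ?_, fun b => ?_, fun i b hb => ?_,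
    fun b => ?_⟩⟩
  · refine ContDiff.isPlot ?_
    refine ContDiff.div (hg i n p hp).contDiff ?_ fun x => (hsum _).ne'
    refine contDiff_iff_contDiffAt.2 fun t => ?_
    obtain ⟨s, hs⟩ := hlf (p t)
    exact contDiffAt_finsum ((hA.continuous_plot n p hp).continuousAt.eventually hs)
      fun j => (hg j n p hp).contDiff.contDiffAt
  · obtain ⟨s, hs⟩ := hlf b
    refine ⟨s, hs.mono fun x hx i hi => ?_⟩
    simp [hx i hi]
  · refine (hsub i b hb).mono fun x hx => ?_
    simp [hx]
  · obtain ⟨s, hs⟩ := hlf b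
    have hs' := hs.self_of_nhds
    rw [finsum_eq_sum_of_forall_notMem (s := s) fun i hi => by simp [hs' i hi],
      ← Finset.sum_div, ← finsum_eq_sum_of_forall_notMem hs', div_self (hsum b).ne']

lemma contDiff_expNegInvGlue : ContDiff ℝ ∞ expNegInvGlue :=
  expNegInvGlue.contDiff (n := ⊤)

/-- Every open cover of a smoothly regular space, given by a neighbourhood of each point, has a
subfamily with a subordinate partition of unity. -/
lemma IsSmoothlyRegular.exists_smoothPartition (hA : IsSmoothlyRegular A) (U : A → Set A)
    (hU : ∀ b, IsOpen (U b)) (hmem : ∀ b, b ∈ U b) :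
    ∃ S : Set A, Nonempty (SmoothPartition fun b : S => U b) := by
  have := hA.secondCountable
  choose f hf hc h1 _ h3 using fun b => hA.exists_bump b (U b) (hU b) (hmem b)
  -- The shift by `1 / 2` makes `F b` vanish on the open set `f b < 1 / 2`, thus in a neighbourhood
  -- of every point outside `U b`, and not merely at such points.
  let F : A → A → ℝ := fun b x => expNegInvGlue (f b x - 1 / 2)
  have hF : ∀ b, DSmooth (F b) := fun b =>
    (contDiff_expNegInvGlue.comp (contDiff_id.sub contDiff_const)).dSmooth.comp (hf b)
  have hFc : ∀ b, Continuous (F b) := fun b =>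
    (contDiff_expNegInvGlue.continuous).comp ((hc b).sub continuous_const)
  have hF0 : ∀ b x, 0 ≤ F b x := fun b x => expNegInvGlue.nonneg _
  obtain ⟨S, hS, hcov⟩ := TopologicalSpace.countable_cover_nhds (f := fun b => {x | 0 < F b x})
    fun b => (isOpen_lt continuous_const (hFc b)).mem_nhds
      (expNegInvGlue.pos_of_pos (by rw [h1]; norm_num))
  obtain ⟨e, he⟩ := (Set.countable_iff_exists_injective.1 hS)
  have hfin : ∀ N, {j : S | e j < N}.Finite := fun N =>
    (Set.finite_lt_nat N).preimage he.injOn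
  -- The `i`-th function is switched off wherever an earlier `F j` is at least `1 / (e i + 1)`. Near
  -- a point some `F j` has a positive lower bound, which kills all sufficiently late indices: local
  -- finiteness. The first index whose `F` is positive at the point survives, because all earlier
  -- `F` vanish there: positivity.
  refine ⟨S, exists_smoothPartition_of_pos hA
    (fun i x => F i x * ∏ j ∈ (hfin (e i)).toFinset, expNegInvGlue (1 / ((e i : ℝ) + 1) - F j x))
    (fun i n p hp => ?_) (fun i x => ?_) (fun b => ?_) (fun i b hb => ?_) fun b => ?_⟩
  · refine ContDiff.isPlot (ContDiff.mul (hF i n p hp).contDiff ?_)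
    exact contDiff_prod fun j _ =>
      contDiff_expNegInvGlue.comp (contDiff_const.sub (hF j n p hp).contDiff)
  · exact mul_nonneg (hF0 _ _) (Finset.prod_nonneg fun j _ => expNegInvGlue.nonneg _)
  · have hb : b ∈ ⋃ x ∈ S, {y | 0 < F x y} := hcov ▸ Set.mem_univ b
    simp only [Set.mem_iUnion, Set.mem_ofPred_eq] at hb
    obtain ⟨j, hj, hjb⟩ := hb
    obtain ⟨N, hN⟩ := exists_nat_one_div_lt (half_pos hjb)
    refine ⟨(hfin (max (e ⟨j, hj⟩ + 1) N)).toFinset, ?_⟩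
    filter_upwards [(isOpen_lt continuous_const (hFc j)).mem_nhds (half_lt_self hjb)] with x hx i hi
    simp only [Set.Finite.mem_toFinset, Set.mem_ofPred_eq, not_lt, sup_le_iff] at hi
    refine mul_eq_zero_of_right _ (Finset.prod_eq_zero (i := ⟨j, hj⟩) ?_ ?_)
    · simp only [Set.Finite.mem_toFinset, Set.mem_ofPred_eq]
      omega
    · refine expNegInvGlue.zero_of_nonpos (sub_nonpos.2 (le_trans ?_ (hN.trans hx).le))
      have : (N : ℝ) ≤ e i := by exact_mod_cast hi.2
      gcongr
  · have hb' : f i b < 1 / 2 := by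
      rw [h3 i b hb]
      norm_num
    filter_upwards [(isOpen_lt (hc i) continuous_const).mem_nhds hb'] with x hx
    refine mul_eq_zero_of_left (expNegInvGlue.zero_of_nonpos ?_) _
    exact sub_nonpos.2 (le_of_lt hx)
  · have hb : b ∈ ⋃ x ∈ S, {y | 0 < F x y} := hcov ▸ Set.mem_univ b
    simp only [Set.mem_iUnion, Set.mem_ofPred_eq] at hb
    obtain ⟨j, hj, hjb⟩ := hb
    have hex : ∃ N, ∃ j : S, e j = N ∧ 0 < F j b := ⟨_, ⟨j, hj⟩, rfl, hjb⟩
    classical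
    obtain ⟨i, hi, hib⟩ := Nat.find_spec hex
    refine ⟨i, mul_pos hib (Finset.prod_pos fun l hl => expNegInvGlue.pos_of_pos ?_)⟩
    simp only [Set.Finite.mem_toFinset, Set.mem_ofPred_eq] at hl
    have hl0 : F l b = 0 := by
      by_contra hne
      exact Nat.find_min hex (hi ▸ hl) ⟨l, rfl, lt_of_le_of_ne (hF0 _ _) (Ne.symm hne)⟩
    rw [hl0, sub_zero]
    positivity

end Regular

/-! ### Gluing forms with a partition of unity -/

section Glue

variable {B X ι : Type*} [TopologicalSpace B] [DiffeologicalSpace B] [DiffeologicalSpace X]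
  {U : ι → Set B} {k : ℕ}

/-- The form `∑ ρ_i η_i` on `X`, for a partition of unity `ρ` on the base of a map `q : X → B` and
forms `η_i` on the preimages of the members of the cover. -/
def SmoothPartition.glue (ρ : SmoothPartition U) (hB : IsSmoothlyRegular B)
    (hU : ∀ i, IsOpen (U i)) {q : X → B} (hq : DSmooth q)
    (η : ∀ i, Form k {x : X // q x ∈ U i}) : Form k X :=
  ⟨fun n p t => ∑ᶠ i, ρ.toFun i (q (p.1 t)) • (η i).lift Subtype.val p.1 t, by
    -- Every term is either zero near `t` or a smooth multiple of a form on a genuine local lift.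
    -- The first case uses that the weight vanishes near each point off `U i`.
    have key : ∀ (n : ℕ) (p : Euc n → X), IsPlot p → ∀ t, ∀ i,
        (∀ᶠ s in 𝓝 t, ρ.toFun i (q (p s)) = 0) ∨
        ∃ r : Euc n → {x : X // q x ∈ U i}, IsPlot r ∧ Subtype.val ∘ r =ᶠ[𝓝 t] p := by
      intro n p hp t i
      have hc := hB.continuous_plot n _ (hq n p hp)
      by_cases ht : q (p t) ∈ U i
      · exact Or.inr (IsPlot.exists_lift_subtype hp
          (hc.continuousAt.eventually ((hU i).mem_nhds ht)))
      · exact Or.inl (hc.continuousAt.eventually (ρ.subordinate i _ ht))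
    refine ⟨fun n p => contDiff_iff_contDiffAt.2 fun t => ?_, fun m n p f hf t => ?_⟩
    · have hc := hB.continuous_plot n _ (hq n p.1 p.2)
      obtain ⟨s, hs⟩ := ρ.locallyFinite (q (p.1 t))
      refine contDiffAt_finsum (s := s) ?_ fun i => ?_
      · filter_upwards [hc.continuousAt.eventually hs] with x hx i hi
        have := hx i hi
        simp only [Function.comp_apply] at this
        simp [this]
      · rcases key n p.1 p.2 t i with h | h
        · refine contDiffAt_const (c := 0) |>.congr_of_eventuallyEq ?_
          filter_upwards [h] with x hx
          simp [hx]
        · exact ((ρ.smooth i n _ (hq n p.1 p.2)).contDiff.contDiffAt).smul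
            ((Form.isBasic_of_injective Subtype.val_injective (η i)).contDiffAt_lift h)
    · obtain ⟨s, hs⟩ := ρ.locallyFinite (q (p.1 (f t)))
      have hs := hs.self_of_nhds
      change ∑ᶠ i, ρ.toFun i (q (p.1 (f t))) • (η i).lift Subtype.val (p.1 ∘ f) t =
        ContinuousAlternatingMap.compContinuousLinearMapCLM (fderiv ℝ f t)
          (∑ᶠ i, ρ.toFun i (q (p.1 (f t))) • (η i).lift Subtype.val p.1 (f t))
      rw [finsum_eq_sum_of_forall_notMem (s := s) fun i hi => by simp [hs i hi],
        finsum_eq_sum_of_forall_notMem (s := s) fun i hi => by simp [hs i hi], map_sum]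
      refine Finset.sum_congr rfl fun i _ => ?_
      rw [map_smul]
      rcases key n p.1 p.2 (f t) i with h | h
      · simp [h.self_of_nhds]
      · rw [(Form.isBasic_of_injective Subtype.val_injective (η i)).lift_comp hf h]
        rfl⟩

lemma SmoothPartition.eval_glue (ρ : SmoothPartition U) (hB : IsSmoothlyRegular B)
    (hU : ∀ i, IsOpen (U i)) {q : X → B} (hq : DSmooth q)
    (η : ∀ i, Form k {x : X // q x ∈ U i}) {n : ℕ} (p : Euc n → X) (hp : IsPlot p) (t : Euc n) :
    (ρ.glue hB hU hq η).eval p hp t =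
      ∑ᶠ i, ρ.toFun i (q (p t)) • (η i).lift Subtype.val p t := rfl

/-- At each point, a glued form is a finite convex combination of the local forms that are defined
at the point. -/
lemma SmoothPartition.exists_weights (ρ : SmoothPartition U) (b : B) :
    ∃ s : Finset ι, (∀ i ∈ s, b ∈ U i) ∧ (∀ i ∉ s, ρ.toFun i b = 0) ∧
      ∑ i ∈ s, ρ.toFun i b = 1 := by
  classical
  obtain ⟨s, hs⟩ := ρ.locallyFinite b
  have hs := hs.self_of_nhds
  have h0 : ∀ i ∉ s.filter (fun i => b ∈ U i), ρ.toFun i b = 0 := by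
    intro i hi
    by_cases his : i ∈ s
    · by_cases hb : b ∈ U i
      · exact absurd (Finset.mem_filter.2 ⟨his, hb⟩) hi
      · exact (ρ.subordinate i b hb).self_of_nhds
    · exact hs i his
  refine ⟨s.filter (fun i => b ∈ U i), fun i hi => (Finset.mem_filter.1 hi).2, h0, ?_⟩
  rw [← finsum_eq_sum_of_forall_notMem h0, ρ.finsum_eq_one]

end Glue


/-! ### Local sections of submersions -/

section LocalSections

variable {M N : Type*} [DiffeologicalSpace M] [TopologicalSpace N] [DiffeologicalSpace N]

/-- Smooth maps with smooth local sections through every point of the base. -/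
structure HasLocalSections (f : M → N) : Prop where
  smooth : DSmooth f
  exists_section : ∀ b : N, ∃ U : Set N, IsOpen U ∧ b ∈ U ∧
    ∃ s : {x : N // x ∈ U} → M, DSmooth s ∧ ∀ x, f (s x) = x

lemma HasLocalSections.isSubduction {f : M → N} (hf : HasLocalSections f)
    (hN : IsSmoothlyRegular N) : IsSubduction f := by
  refine ⟨hf.smooth, fun n p hp t => ?_⟩
  obtain ⟨U, hU, htU, s, hs, hfs⟩ := hf.exists_section (p t)
  obtain ⟨q, hq, hqp⟩ := IsPlot.exists_lift_subtype (P := (· ∈ U)) hp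
    ((hN.continuous_plot n p hp).continuousAt.eventually (hU.mem_nhds htU))
  refine ⟨s ∘ q, hs n q hq, ?_⟩
  filter_upwards [hqp] with x hx
  rw [← hx]
  exact hfs (q x)

lemma IsSmoothInto.prodMk_const {W K : Type*} [AddCommGroup W] [Module ℝ W] [TopologicalSpace W]
    [AddCommGroup K] [Module ℝ K] [TopologicalSpace K] [IsFrechet W] [IsFrechet K] {n : ℕ}
    {p : Euc n → W} (hp : IsSmoothInto p) (x : K) : IsSmoothInto (fun t => (p t, x)) := by
  intro l
  have h := (hp (l.comp (ContinuousLinearMap.inl ℝ W K))).add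
    (contDiff_const (c := l (0, x)))
  have e : (fun t => l (p t, x)) = fun t => l.comp (ContinuousLinearMap.inl ℝ W K) (p t) +
      l (0, x) := funext fun t => by simp [← map_add]
  rw [e]
  exact h

/-- In the charts the section through `m` freezes the `K`-coordinate at that of `m`; its domain is
where `(w, (e m).2)` stays in the image of the chart. -/
lemma IsSurjSubmersion.hasLocalSections [TopologicalSpace M] {f : M → N}
    (hf : IsSurjSubmersion f) : HasLocalSections f := by
  refine ⟨hf.smooth, fun b => ?_⟩
  obtain ⟨m, rfl⟩ := hf.surjective b
  obtain ⟨W, K, _, _, _, _, _, _, _, _, e, c, hm, he, hc, hec⟩ := hf.exists_charts m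
  let g : W → W × K := fun w => (w, (e m).2)
  have hg : Continuous g := by fun_prop
  have hgm : g (c (f m)) = e m := Prod.ext (hec m hm).2 rfl
  refine ⟨c.source ∩ c ⁻¹' (g ⁻¹' e.target),
    c.continuousOn.isOpen_inter_preimage c.open_source (e.open_target.preimage hg),
    ⟨(hec m hm).1, ?_⟩, fun x => e.symm (g (c x)), fun n p hp => ?_, fun x => ?_⟩
  · change g (c (f m)) ∈ e.target
    rw [hgm]
    exact e.map_source hm
  · refine (he n (fun t => e.symm (g (c (p t)))) fun t => e.map_target (p t).2.2).2 ?_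
    have h1 : IsSmoothInto (fun t => c (p t)) :=
      (hc n (fun t => (p t : N)) fun t => (p t).2.1).1 hp
    have h2 := h1.prodMk_const (e m).2
    have h3 : (fun t => (c (p t), (e m).2)) = fun t => e (e.symm (g (c (p t)))) :=
      funext fun t => (e.right_inv (p t).2.2).symm
    exact h3 ▸ h2
  · have h1 : e.symm (g (c x)) ∈ e.source := e.map_target x.2.2
    refine c.injOn (hec _ h1).1 x.2.1 ?_
    rw [(hec _ h1).2, e.right_inv x.2.2]

end LocalSections

/-! ### Alternating sums -/

section AltSum

variable {k n : ℕ}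

lemma smul_altSign_succ {l : ℕ} (j : Fin l) (x : Euc n [⋀^Fin k]→L[ℝ] ℝ) :
    (altSign j.succ : ℝ) • x = -((altSign j : ℝ) • x) := by
  have : (altSign j.succ : ℝ) = -(altSign j : ℝ) := by
    simp [altSign, pow_succ]
  rw [this]
  exact neg_smul (altSign j : ℝ) x

lemma smul_altSign_zero {l : ℕ} (x : Euc n [⋀^Fin k]→L[ℝ] ℝ) :
    (altSign (0 : Fin (l + 1)) : ℝ) • x = x := by
  simp [altSign]

lemma sum_smul_altSign_succ {l : ℕ} (x : Fin (l + 1) → Euc n [⋀^Fin k]→L[ℝ] ℝ) :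
    ∑ j, (altSign j : ℝ) • x j = x 0 - ∑ j : Fin l, (altSign j : ℝ) • x j.succ := by
  rw [Fin.sum_univ_succ, smul_altSign_zero, sub_eq_add_neg, ← Finset.sum_neg_distrib]
  simp only [smul_altSign_succ]

lemma sum_smul_altSign_two (x : Fin 2 → Euc n [⋀^Fin k]→L[ℝ] ℝ) :
    ∑ j, (altSign j : ℝ) • x j = x 0 - x 1 := by
  simp [sum_smul_altSign_succ, smul_altSign_zero]

end AltSum

/-! ### The exact sequence of forms on the fibre powers -/

section Exactness

variable {A B : Type*} [DiffeologicalSpace A] {k : ℕ}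

lemma FibProd.dSmooth_face (π : A → B) {l : ℕ} (i : Fin (l + 1)) :
    DSmooth (FibProd.face π (k := l) i) := fun _ _ hp j => hp (i.succAbove j)

/-- The alternating sum of the pullbacks along the face maps of the fibre powers. -/
def FibProd.coboundary (π : A → B) (l : ℕ) :
    Form k (FibProd π l) →ₗ[ℝ] Form k (FibProd π (l + 1)) :=
  ∑ i : Fin (l + 1), (altSign i : ℝ) • Form.pullback (FibProd.face π i) (FibProd.dSmooth_face π i)

lemma FibProd.eval_coboundary (π : A → B) (l : ℕ) (η : Form k (FibProd π l)) {n : ℕ}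
    (p : Euc n → FibProd π (l + 1)) (hp : IsPlot p) (t : Euc n) :
    (FibProd.coboundary π l η).eval p hp t = ∑ i : Fin (l + 1), (altSign i : ℝ) •
      η.eval (FibProd.face π i ∘ p) (FibProd.dSmooth_face π i n p hp) t := by
  simp [FibProd.coboundary, LinearMap.sum_apply]

variable [TopologicalSpace B] [DiffeologicalSpace B]

/-- Inserting a local section as the first factor of a fibre power. -/
def FibProd.insertSection (π : A → B) (l : ℕ) {U : Set B} (s : {x : B // x ∈ U} → A)
    (hs : ∀ x, π (s x) = x) (a : {a : FibProd π (l + 1) // π (a.1 0) ∈ U}) : FibProd π (l + 2) :=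
  ⟨Fin.cons (s ⟨π (a.1.1 0), a.2⟩) a.1.1, by
    have h : ∀ i, π ((Fin.cons (s ⟨π (a.1.1 0), a.2⟩) a.1.1 : Fin (l + 2) → A) i) =
        π (a.1.1 0) := by
      intro i
      refine Fin.cases ?_ (fun i => ?_) i
      · exact hs _
      · exact a.1.2 i 0
    intro i j
    rw [h, h]⟩

omit [TopologicalSpace B] in
lemma FibProd.dSmooth_insertSection (π : A → B) (hπ : DSmooth π) (l : ℕ) {U : Set B}
    (s : {x : B // x ∈ U} → A) (hs : ∀ x, π (s x) = x) (hs' : DSmooth s) :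
    DSmooth (FibProd.insertSection π l s hs) := by
  intro n p hp i
  refine Fin.cases ?_ (fun i => ?_) i
  · exact hs' n (fun t => ⟨π ((p t).1.1 0), (p t).2⟩) (hπ n (fun t => (p t).1.1 0) (hp 0))
  · exact hp i

/-- Exactness of the sequence of forms on the fibre powers of a map with local sections. -/
theorem FibProd.exists_coboundary_eq {π : A → B} (hB : IsSmoothlyRegular B)
    (hπ : HasLocalSections π) (l : ℕ) (η : Form k (FibProd π (l + 2)))
    (hη : FibProd.coboundary π (l + 2) η = 0) :
    ∃ ζ : Form k (FibProd π (l + 1)), FibProd.coboundary π (l + 1) ζ = η := by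
  choose U hU hbU s hs hπs using hπ.exists_section
  obtain ⟨S, ⟨ρ⟩⟩ := hB.exists_smoothPartition U hU hbU
  have hq : DSmooth (fun a : FibProd π (l + 1) => π (a.1 0)) :=
    hπ.smooth.comp (FibProd.dSmooth_pr π 0)
  -- The contracting homotopy: `σ` inserts the local section in front, so `d_0 σ = id` and `d_{j+1}
  -- σ = σ d_j`, whence `δη = 0` gives `δ(σ^*η) = η` over `U i`. The weights depend only on the
  -- point of `B`, which all faces share, so the glued form is still a primitive.
  let σ := fun i : S => FibProd.insertSection π l (s i) (hπs i)
  have hσ : ∀ i, DSmooth (σ i) := fun i =>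
    FibProd.dSmooth_insertSection π hπ.smooth l (s i) (hπs i) (hs i)
  refine ⟨ρ.glue hB (fun i => hU i) hq fun i => Form.pullback (σ i) (hσ i) η,
    Form.ext_eval fun n p hp t => ?_⟩
  have hpq : IsPlot (fun t => π ((p t).1 0)) := hπ.smooth n _ (hp 0)
  obtain ⟨w, hwU, hw0, hw1⟩ := ρ.exists_weights (π ((p t).1 0))
  rw [FibProd.eval_coboundary]
  have h1 : ∀ j : Fin (l + 2), π ((FibProd.face π j (p t)).1 0) = π ((p t).1 0) :=
    fun j => (p t).2 _ _
  have h2 : ∀ i ∈ w, ∑ j : Fin (l + 2), (altSign j : ℝ) •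
      (Form.pullback (σ i) (hσ i) η).lift Subtype.val (FibProd.face π j ∘ p) t =
        η.eval p hp t := by
    intro i hi
    obtain ⟨r, hr, hrp⟩ := IsPlot.exists_lift_subtype
      (P := fun a : FibProd π (l + 2) => π (a.1 0) ∈ U i) hp (t := t)
      ((hB.continuous_plot n _ hpq).continuousAt.eventually ((hU i).mem_nhds (hwU i hi)))
    let f : Fin (l + 2) → Euc n → {a : FibProd π (l + 1) // π (a.1 0) ∈ U i} := fun j x =>
      ⟨FibProd.face π j (r x).1, by
        rw [show π ((FibProd.face π j (r x).1).1 0) = π ((r x).1.1 0) from (r x).1.2 _ _]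
        exact (r x).2⟩
    have hf : ∀ j, IsPlot (f j) := fun j => FibProd.dSmooth_face π j n _ hr
    have h3 : ∀ j, (Form.pullback (σ i) (hσ i) η).lift Subtype.val (FibProd.face π j ∘ p) t =
        η.eval (σ i ∘ f j) (hσ i n _ (hf j)) t := by
      intro j
      rw [(Form.isBasic_of_injective Subtype.val_injective _).lift_eq (hf j),
        Form.eval_pullback]
      filter_upwards [hrp] with x hx
      rw [Function.comp_apply, Function.comp_apply, ← hx]
      rfl
    let g : Euc n → FibProd π (l + 3) := FibProd.insertSection π (l + 1) (s i) (hπs i) ∘ r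
    have hg : IsPlot g :=
      FibProd.dSmooth_insertSection π hπ.smooth (l + 1) (s i) (hπs i) (hs i) n r hr
    have h4 := congrArg (fun ζ => Form.eval ζ g hg t) hη
    simp only [FibProd.eval_coboundary, Form.eval_zero] at h4
    rw [sum_smul_altSign_succ] at h4
    have h5 : η.eval (FibProd.face π 0 ∘ g) (FibProd.dSmooth_face π 0 n g hg) t =
        η.eval p hp t := by
      refine η.eval_congr _ _ ?_
      filter_upwards [hrp] with x hx
      rw [← hx]
      rfl
    have h6 : ∀ j : Fin (l + 2), FibProd.face π j.succ ∘ g = σ i ∘ f j := by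
      intro j
      funext x
      refine Subtype.ext (funext fun a => ?_)
      refine Fin.cases ?_ (fun a => ?_) a
      · change (Fin.cons _ (r x).1.1 : Fin (l + 3) → A) (j.succ.succAbove 0) = _
        rw [Fin.succ_succAbove_zero, Fin.cons_zero]
        exact congrArg (s i) (Subtype.ext ((r x).1.2 _ _))
      · change (Fin.cons _ (r x).1.1 : Fin (l + 3) → A) (j.succ.succAbove a.succ) = _
        rw [Fin.succ_succAbove_succ, Fin.cons_succ]
        rfl
    rw [h5] at h4
    have h7 : ∀ j : Fin (l + 2), η.eval (FibProd.face π j.succ ∘ g)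
        (FibProd.dSmooth_face π _ n g hg) t = η.eval (σ i ∘ f j) (hσ i n _ (hf j)) t :=
      fun j => η.eval_congr' _ _ (h6 j) t
    simp only [h7] at h4
    simp only [h3]
    exact (sub_eq_zero.1 h4).symm
  calc _ = ∑ j : Fin (l + 2), (altSign j : ℝ) • ∑ i ∈ w, ρ.toFun i (π ((p t).1 0)) •
        (Form.pullback (σ i) (hσ i) η).lift Subtype.val (FibProd.face π j ∘ p) t := by
        refine Finset.sum_congr rfl fun j _ => ?_
        congr 1
        rw [SmoothPartition.eval_glue]
        simp only [Function.comp_apply, h1]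
        exact finsum_eq_sum_of_forall_notMem fun i hi => by rw [hw0 i hi, zero_smul]
    _ = ∑ i ∈ w, ρ.toFun i (π ((p t).1 0)) • η.eval p hp t := by
        simp only [Finset.smul_sum]
        rw [Finset.sum_comm]
        refine Finset.sum_congr rfl fun i hi => ?_
        rw [← h2 i hi, Finset.smul_sum]
        exact Finset.sum_congr rfl fun j _ => smul_comm _ _ _
    _ = η.eval p hp t := by rw [← Finset.sum_smul, hw1, one_smul]

omit [TopologicalSpace B] [DiffeologicalSpace B] in
lemma FibProd.eval_delta (π : A → B) (η : Form k A) {n : ℕ}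
    (p : Euc n → FibProd π 2) (hp : IsPlot p) (t : Euc n) :
    (delta π η).eval p hp t = η.eval (fun s => (p s).1 1) (hp 1) t -
      η.eval (fun s => (p s).1 0) (hp 0) t := rfl

/-- Exactness at the second fibre power. -/
theorem exists_delta_eq {π : A → B} (hB : IsSmoothlyRegular B)
    (hπ : HasLocalSections π) (η : Form k (FibProd π 2))
    (hη : FibProd.coboundary π 2 η = 0) : ∃ ζ : Form k A, delta π ζ = η := by
  obtain ⟨ζ, hζ⟩ := FibProd.exists_coboundary_eq hB hπ 0 η hη
  -- `delta` starts from `A` rather than `A^{[1]}`, so the primitive is transported along the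
  -- identification of the two.
  have hd : DSmooth (fun a : A => (⟨fun _ => a, fun _ _ => rfl⟩ : FibProd π 1)) :=
    fun _ _ hp _ => hp
  refine ⟨Form.pullback _ hd ζ, ?_⟩
  rw [← hζ]
  refine Form.ext_eval fun n p hp t => ?_
  rw [FibProd.eval_delta, FibProd.eval_coboundary, sum_smul_altSign_two]
  refine congrArg₂ (· - ·) (ζ.eval_congr' _ _ (funext fun s => Subtype.ext (funext fun i => ?_)) t)
    (ζ.eval_congr' _ _ (funext fun s => Subtype.ext (funext fun i => ?_)) t)
  · obtain rfl : i = 0 := Subsingleton.elim (α := Fin 1) _ _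
    rfl
  · obtain rfl : i = 0 := Subsingleton.elim (α := Fin 1) _ _
    rfl

end Exactness


/-! ### The Maurer–Cartan form -/

section MaurerCartan

variable {n : ℕ}

lemma isPlot_circle_mul {g h : Euc n → Circle} (hg : IsPlot g) (hh : IsPlot h) :
    IsPlot (fun t => g t * h t) := by
  rw [isPlot_circle_iff] at *
  simpa using hg.mul hh

lemma isPlot_circle_inv {g : Euc n → Circle} (hg : IsPlot g) : IsPlot (fun t => (g t)⁻¹) := by
  rw [isPlot_circle_iff] at *
  simp only [Circle.coe_inv_eq_conj]
  exact Complex.conjCLE.contDiff.comp hg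

/-- The group of plots of `U(1)`. -/
def circlePlots (n : ℕ) : Subgroup (Euc n → Circle) where
  carrier := {g | IsPlot g}
  mul_mem' hg hh := isPlot_circle_mul hg hh
  one_mem' := isPlot_const
  inv_mem' hg := isPlot_circle_inv hg

/-- By the Leibniz rule and `|g| = |h| = 1`, the conjugate of `gh` times `d(gh)` splits as a sum.
This converts each multiplicative identity between `U(1)`-valued sections into an additive one
between 1-forms. -/
lemma eval_maurerCartan_mul {g h : Euc n → Circle} (hg : IsPlot g) (hh : IsPlot h)
    (hgh : IsPlot (fun t => g t * h t)) (t : Euc n) :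
    maurerCartan.eval (fun t => g t * h t) hgh t =
      maurerCartan.eval g hg t + maurerCartan.eval h hh t := by
  ext v
  have hg' : ContDiff ℝ ∞ (fun t => (g t : ℂ)) := hg
  have hh' : ContDiff ℝ ∞ (fun t => (h t : ℂ)) := hh
  have e : fderiv ℝ (fun s => ((g s * h s : Circle) : ℂ)) t =
      (g t : ℂ) • fderiv ℝ (fun s => (h s : ℂ)) t + (h t : ℂ) • fderiv ℝ (fun s => (g s : ℂ)) t := by
    simp only [Circle.coe_mul]
    exact fderiv_fun_mul (hg'.differentiable (by simp) t) (hh'.differentiable (by simp) t)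
  change ((star ((g t * h t : Circle) : ℂ)) • fderiv ℝ (fun s => ((g s * h s : Circle) : ℂ)) t
      (v 0)).im = ((star (g t : ℂ)) • fderiv ℝ (fun s => (g s : ℂ)) t (v 0)).im +
    ((star (h t : ℂ)) • fderiv ℝ (fun s => (h s : ℂ)) t (v 0)).im
  rw [e, ← Complex.add_im]
  congr 1
  have h1 : star (g t : ℂ) * g t = 1 := by
    rw [Complex.star_def, Complex.conj_mul', Circle.norm_coe]; simp
  have h2 : star (h t : ℂ) * h t = 1 := by
    rw [Complex.star_def, Complex.conj_mul', Circle.norm_coe]; simp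
  simp only [Circle.coe_mul, star_mul', smul_eq_mul, add_apply,
    smul_apply]
  linear_combination (star (h t : ℂ) * (fderiv ℝ (fun s => (h s : ℂ)) t) (v 0)) * h1 +
    (star (g t : ℂ) * (fderiv ℝ (fun s => (g s : ℂ)) t) (v 0)) * h2

/-- Evaluation of the Maurer–Cartan form as a homomorphism on the group of plots. -/
def maurerCartanHom (t : Euc n) :
    circlePlots n →* Multiplicative (Euc n [⋀^Fin 1]→L[ℝ] ℝ) :=
  MonoidHom.mk' (fun g => Multiplicative.ofAdd (maurerCartan.eval g.1 g.2 t))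
    fun g h => congrArg Multiplicative.ofAdd (eval_maurerCartan_mul g.2 h.2 _ t)

lemma eval_maurerCartan_one (h : IsPlot (fun _ : Euc n => (1 : Circle))) (t : Euc n) :
    maurerCartan.eval (fun _ => 1) h t = 0 :=
  congrArg Multiplicative.toAdd (map_one (maurerCartanHom t))

lemma isPlot_circle_prod_zpow {ι : Type*} [Fintype ι] (ε : ι → ℤ) {g : ι → Euc n → Circle}
    (hg : ∀ i, IsPlot (g i)) : IsPlot (fun t => ∏ i, g i t ^ ε i) := by
  have := (∏ i, (⟨g i, hg i⟩ : circlePlots n) ^ ε i).2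
  have e : (∏ i, (⟨g i, hg i⟩ : circlePlots n) ^ ε i).1 = fun t => ∏ i, g i t ^ ε i := by
    funext t
    simp
  rwa [e] at this

lemma eval_maurerCartan_prod_zpow {ι : Type*} [Fintype ι] (ε : ι → ℤ) {g : ι → Euc n → Circle}
    (hg : ∀ i, IsPlot (g i)) (h : IsPlot (fun t => ∏ i, g i t ^ ε i)) (t : Euc n) :
    maurerCartan.eval (fun t => ∏ i, g i t ^ ε i) h t =
      ∑ i, ε i • maurerCartan.eval (g i) (hg i) t := by
  have h1 : (∏ i, (⟨g i, hg i⟩ : circlePlots n) ^ ε i).1 = fun t => ∏ i, g i t ^ ε i := by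
    funext t
    simp
  have h2 := congrArg Multiplicative.toAdd
    (map_prod (maurerCartanHom t) (fun i => (⟨g i, hg i⟩ : circlePlots n) ^ ε i) Finset.univ)
  simp only [map_zpow, toAdd_prod, toAdd_zpow] at h2
  rw [← Form.eval_congr' maurerCartan (∏ i, (⟨g i, hg i⟩ : circlePlots n) ^ ε i).2 h h1]
  exact h2

/-- The Maurer–Cartan form is closed. -/
lemma d_maurerCartan : Form.d maurerCartan = 0 := by
  refine Form.ext_eval fun n p hp t => ?_
  rw [Form.eval_d, Form.eval_zero]
  have hp' : ContDiff ℝ ∞ (fun s => (p s : ℂ)) := hp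
  -- Rotating so that the value at `t` becomes `1` avoids the cut of the logarithm. Near `t` the
  -- form is then `dθ` for the smooth angle `θ`.
  let u : Euc n → ℂ := fun s => star (p t : ℂ) * p s
  have hu : ContDiff ℝ ∞ u := contDiff_const.mul hp'
  have h1 : ∀ z : Circle, star (z : ℂ) * z = 1 := fun z => by
    rw [Complex.star_def, Complex.conj_mul', Circle.norm_coe]; simp
  have hut : u t ∈ Complex.slitPlane := by
    change star (p t : ℂ) * p t ∈ _
    rw [h1]
    exact Complex.one_mem_slitPlane
  let θ : Euc n → ℝ := fun s => (Complex.log (u s)).im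
  have hθ : ContDiffAt ℝ ∞ θ t :=
    Complex.imCLM.contDiff.contDiffAt.comp t
      (((Complex.contDiffAt_log hut).restrict_scalars ℝ).comp t hu.contDiffAt)
  have key : maurerCartan.eval p hp =ᶠ[𝓝 t]
      extDeriv (fun s => ContinuousAlternatingMap.constOfIsEmpty ℝ (Euc n) (Fin 0) (θ s)) := by
    filter_upwards [hu.continuous.continuousAt.eventually
      (Complex.isOpen_slitPlane.mem_nhds hut)] with s hs
    rw [extDeriv_constOfIsEmpty]
    have h2 : HasFDerivAt u (star (p t : ℂ) • fderiv ℝ (fun s => (p s : ℂ)) s) s :=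
      (hp'.differentiable (by simp) s).hasFDerivAt.const_mul _
    have h3 := Complex.imCLM.hasFDerivAt.comp s
      (((Complex.hasDerivAt_log hs).hasFDerivAt.restrictScalars ℝ).comp s h2)
    have h4 : HasFDerivAt θ _ s := h3
    rw [h4.fderiv]
    ext v
    change ((star (p s : ℂ)) • fderiv ℝ (fun s => (p s : ℂ)) s (v 0)).im =
      ((star (p t : ℂ) • fderiv ℝ (fun s => (p s : ℂ)) s (v 0)) • (u s)⁻¹).im
    congr 1
    rw [smul_eq_mul, smul_eq_mul, smul_eq_mul, mul_right_comm, mul_comm _ (u s)⁻¹]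
    congr 1
    have h5 : (star (p t : ℂ)) ≠ 0 := by simp
    have h6 : (p s : ℂ) ≠ 0 := by simp
    change _ = (star (p t : ℂ) * p s)⁻¹ * star (p t : ℂ)
    field_simp
    exact h1 (p s)
  rw [key.extDeriv_eq]
  exact extDeriv_extDeriv_apply (r := ∞)
    ((ContinuousAlternatingMap.constOfIsEmptyLIE ℝ (Euc n) ℝ (Fin 0)).contDiff.contDiffAt.comp t hθ)
    (by
      rw [minSmoothness_of_isRCLikeNormedField]
      exact WithTop.coe_le_coe.2 le_top)

end MaurerCartan


/-! ### Connections on `U(1)`-bundles -/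

section Connections

variable {A : Type*} [TopologicalSpace A] [DiffeologicalSpace A] {P : U1Bundle A} {n k : ℕ}

lemma isPlot_prod_mk {X Y : Type*} [DiffeologicalSpace X] [DiffeologicalSpace Y]
    {p : Euc n → X} {q : Euc n → Y} (hp : IsPlot p) (hq : IsPlot q) :
    IsPlot (fun t => (p t, q t)) := ⟨hp, hq⟩

lemma U1Bundle.isPlot_smul (P : U1Bundle A) {g : Euc n → Circle} {e : Euc n → P.Total}
    (hg : IsPlot g) (he : IsPlot e) : IsPlot (fun t => g t • e t) :=
  P.dSmooth_smul n (fun t => (g t, e t)) (isPlot_prod_mk hg he)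

lemma U1Bundle.hasLocalSections (P : U1Bundle A) : HasLocalSections P.proj := by
  refine ⟨P.dSmooth_proj, fun a => ?_⟩
  obtain ⟨U, hU, ha, φ, -, hφ', hφp, -⟩ := P.exists_trivialization a
  refine ⟨U, hU, ha, fun x => (φ.symm (x, 1)).1, fun n p hp => ?_, fun x => ?_⟩
  · exact hφ' n (fun t => (p t, 1)) (isPlot_prod_mk hp isPlot_const)
  · rw [← hφp, Equiv.apply_symm_apply]

lemma U1Bundle.isSubduction (P : U1Bundle A) (hA : IsSmoothlyRegular A) : IsSubduction P.proj :=
  P.hasLocalSections.isSubduction hA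

/-- Two plots of the total space over the same plot of the base differ by a plot of `U(1)`. -/
lemma U1Bundle.exists_smul_eq (P : U1Bundle A) (hA : IsSmoothlyRegular A)
    {e e' : Euc n → P.Total} (he : IsPlot e) (he' : IsPlot e') (h : P.proj ∘ e = P.proj ∘ e') :
    ∃ g : Euc n → Circle, IsPlot g ∧ e' = fun t => g t • e t := by
  -- The quotient of the fibre coordinates is a local solution, and the trivialisation also makes
  -- the action free. Uniqueness of the quotient is what makes the diagonal choice `g t t` below
  -- agree locally with a single plot.
  have key : ∀ t, ∃ g : Euc n → Circle, IsPlot g ∧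
      ∀ᶠ s in 𝓝 t, e' s = g s • e s ∧ ∀ c : Circle, e' s = c • e s → c = g s := by
    intro t
    obtain ⟨U, hU, ha, φ, hφ, -, hφp, hφs⟩ := P.exists_trivialization (P.proj (e t))
    have hev := (hA.continuous_plot n _ (P.dSmooth_proj n e he)).continuousAt.eventually
      (hU.mem_nhds ha)
    obtain ⟨q, hq, hqe⟩ := IsPlot.exists_lift_subtype (P := fun e => P.proj e ∈ U) he hev
    obtain ⟨q', hq', hqe'⟩ := IsPlot.exists_lift_subtype (P := fun e => P.proj e ∈ U) he' (by
      filter_upwards [hev] with s hs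
      have := congrFun h s
      simp only [Function.comp_apply] at this hs
      exact this ▸ hs)
    refine ⟨fun s => (φ (q' s)).2 * ((φ (q s)).2)⁻¹,
      isPlot_circle_mul (hφ n q' hq').2 (isPlot_circle_inv (hφ n q hq).2), ?_⟩
    filter_upwards [hqe, hqe'] with s hs hs'
    simp only [Function.comp_apply] at hs hs'
    have hps : P.proj (e s) = P.proj (e' s) := congrFun h s
    refine ⟨?_, fun c hc => ?_⟩
    · have hU' : P.proj (((φ (q' s)).2 * ((φ (q s)).2)⁻¹) • e s) ∈ U := by
        rw [P.proj_smul, ← hs]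
        exact (q s).2
      have h1 := hφs ((φ (q' s)).2 * ((φ (q s)).2)⁻¹) (q s) ⟨_, hU'⟩ (by rw [hs])
      rw [inv_mul_cancel_right] at h1
      have h2 : φ (q' s) = φ ⟨_, hU'⟩ := by
        rw [h1]
        refine Prod.ext (Subtype.ext ?_) rfl
        rw [hφp, hφp, hs, hs', hps]
      exact hs'.symm.trans (congrArg Subtype.val (φ.injective h2))
    · have h1 := hφs c (q s) (q' s) (by rw [hs, hs', hc])
      rw [h1]
      simp
  choose g hg hge using key
  refine ⟨fun t => g t t, isPlot_of_locally fun t => ⟨g t, hg t, ?_⟩,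
    funext fun t => (hge t).self_of_nhds.1⟩
  filter_upwards [hge t] with s hs
  exact (hge s).self_of_nhds.2 _ hs.1

/-- A form on the total space is a connection if it transforms on plots as a connection does. -/
lemma U1Bundle.isConnection_iff {w : Form 1 P.Total} :
    P.IsConnection w ↔ ∀ (n : ℕ) (g : Euc n → Circle) (e : Euc n → P.Total) (hg : IsPlot g)
      (he : IsPlot e) (t : Euc n), w.eval (fun t => g t • e t) (P.isPlot_smul hg he) t =
        maurerCartan.eval g hg t + w.eval e he t := by
  refine ⟨fun h n g e hg he t => ?_, fun h => Form.ext_eval fun n p hp t => ?_⟩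
  · exact congrArg (fun ζ => Form.eval ζ (fun t => (g t, e t)) (isPlot_prod_mk hg he) t) h
  · exact h n (fun t => (p t).1) (fun t => (p t).2) hp.1 hp.2 t

/-- Every `U(1)`-bundle on a smoothly regular space has a connection. -/
theorem U1Bundle.exists_isConnection (P : U1Bundle A) (hA : IsSmoothlyRegular A) :
    ∃ w : Form 1 P.Total, P.IsConnection w := by
  choose U hU hmem φ hφ _ _ hφs using P.exists_trivialization
  obtain ⟨S, ⟨ρ⟩⟩ := hA.exists_smoothPartition U hU hmem
  -- A trivialisation gives the local connection `ψ^*dθ`. The transformation law is affine, so it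
  -- survives combinations with weights of sum one.
  let ψ : ∀ i : S, {e : P.Total // P.proj e ∈ U i} → Circle := fun i e => (φ i e).2
  have hψ : ∀ i, DSmooth (ψ i) := fun i n p hp => (hφ i n p hp).2
  refine ⟨ρ.glue hA (fun i => hU i) P.dSmooth_proj fun i => Form.pullback (ψ i) (hψ i) maurerCartan,
    isConnection_iff.2 fun n g e hg he t => ?_⟩
  obtain ⟨s, hsU, hs0, hs1⟩ := ρ.exists_weights (P.proj (e t))
  rw [SmoothPartition.eval_glue, SmoothPartition.eval_glue]
  simp only [P.proj_smul]
  rw [finsum_eq_sum_of_forall_notMem (s := s) fun i hi => by rw [hs0 i hi, zero_smul],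
    finsum_eq_sum_of_forall_notMem (s := s) fun i hi => by rw [hs0 i hi, zero_smul]]
  have h1 : ∀ i ∈ s, (Form.pullback (ψ i) (hψ i) maurerCartan).lift Subtype.val
      (fun t => g t • e t) t = maurerCartan.eval g hg t +
        (Form.pullback (ψ i) (hψ i) maurerCartan).lift Subtype.val e t := by
    intro i hi
    obtain ⟨r, hr, hre⟩ := IsPlot.exists_lift_subtype (P := fun e => P.proj e ∈ U i) he (t := t)
      ((hA.continuous_plot n _ (P.dSmooth_proj n e he)).continuousAt.eventually
        ((hU i).mem_nhds (hsU i hi)))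
    let r' : Euc n → {e : P.Total // P.proj e ∈ U i} := fun s =>
      ⟨g s • (r s).1, by rw [P.proj_smul]; exact (r s).2⟩
    have hr' : IsPlot r' := P.isPlot_smul hg hr
    rw [(Form.isBasic_of_injective Subtype.val_injective _).lift_eq hr hre,
      (Form.isBasic_of_injective Subtype.val_injective _).lift_eq hr' (by
        filter_upwards [hre] with x hx
        rw [← hx]
        rfl), Form.eval_pullback, Form.eval_pullback]
    have h2 : ψ i ∘ r' = fun s => g s * (ψ i ∘ r) s :=
      funext fun s => congrArg Prod.snd (hφs i (g s) (r s) (r' s) rfl)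
    rw [← eval_maurerCartan_mul hg (hψ i n r hr)
      (isPlot_circle_mul hg (hψ i n r hr))]
    exact maurerCartan.eval_congr' _ _ h2 t
  rw [Finset.sum_congr rfl fun i hi => by rw [h1 i hi, smul_add], Finset.sum_add_distrib,
    ← Finset.sum_smul, hs1, one_smul]

/-- The difference of two connections is the pullback of a form on the base. -/
lemma U1Bundle.IsConnection.exists_sub_eq (hA : IsSmoothlyRegular A) {w w' : Form 1 P.Total}
    (hw : P.IsConnection w) (hw' : P.IsConnection w') :
    ∃ κ : Form 1 A, Form.pullback P.proj P.dSmooth_proj κ = w - w' := by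
  refine (P.isSubduction hA).exists_pullback_eq fun n q q' hq hq' h t => ?_
  obtain ⟨g, hg, rfl⟩ := P.exists_smul_eq hA hq hq' h
  rw [Form.eval_sub, Form.eval_sub, isConnection_iff.1 hw n g q hg hq t,
    isConnection_iff.1 hw' n g q hg hq t, add_sub_add_left_eq_sub]

/-- The curvature of a connection is a form on the base. -/
lemma U1Bundle.IsConnection.exists_curvature (hA : IsSmoothlyRegular A) {w : Form 1 P.Total}
    (hw : P.IsConnection w) :
    ∃ Ω : Form 2 A, Form.pullback P.proj P.dSmooth_proj Ω = Form.d w := by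
  refine (P.isSubduction hA).exists_pullback_eq fun n q q' hq hq' h t => ?_
  obtain ⟨g, hg, rfl⟩ := P.exists_smul_eq hA hq hq' h
  -- Differentiating the connection condition removes the Maurer–Cartan term, since that form is
  -- closed; `dw` is therefore unaffected by `q ↦ g • q`.
  have h1 := congrArg Form.d hw
  rw [map_add, Form.d_pullback, Form.d_pullback, Form.d_pullback, d_maurerCartan, map_zero,
    zero_add] at h1
  exact (congrArg (fun ζ => Form.eval ζ (fun t => (g t, q t)) (isPlot_prod_mk hg hq) t) h1).symm

lemma U1Bundle.IsConnection.sub_pullback {w : Form 1 P.Total} (hw : P.IsConnection w)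
    (κ : Form 1 A) : P.IsConnection (w - Form.pullback P.proj P.dSmooth_proj κ) := by
  refine isConnection_iff.2 fun n g e hg he t => ?_
  rw [Form.eval_sub, Form.eval_sub, isConnection_iff.1 hw n g e hg he t, Form.eval_pullback,
    Form.eval_pullback, add_sub_assoc]
  congr 2
  exact κ.eval_congr' _ _ (funext fun s => P.proj_smul _ _) t

end Connections

/-! ### Sections of tensor products of bundles -/

section TensorSections

variable {A B ι : Type*} [TopologicalSpace A] [DiffeologicalSpace A] [DiffeologicalSpace B]
  [Fintype ι] {P : U1Bundle A} {f : ι → B → A} {ε : ι → ℤ} {n k : ℕ}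

/-- Plots in finitely many spaces lift through a subduction simultaneously, after a
reparametrisation which is the identity near a given point. -/
lemma IsSubduction.exists_lifts {κ M N : Type*} [Finite κ] [DiffeologicalSpace M]
    [DiffeologicalSpace N] {π : M → N} (hπ : IsSubduction π) {c : κ → Euc n → N}
    (hc : ∀ i, IsPlot (c i)) (t : Euc n) :
    ∃ g : Euc n → Euc n, ContDiff ℝ ∞ g ∧ g =ᶠ[𝓝 t] id ∧ ∃ e : κ → Euc n → M,
      (∀ i, IsPlot (e i)) ∧ ∀ i s, π (e i s) = c i (g s) := by
  choose q hq hqc using fun i => hπ.exists_lift n (c i) (hc i) t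
  obtain ⟨g, hg, hgU, hgt⟩ := exists_contDiff_eventuallyEq_id (eventually_all.2 hqc)
  exact ⟨g, hg, hgt, fun i => q i ∘ g, fun i => isPlot_reparam (hq i) hg, fun i s => hgU s i⟩

/-- To prove that forms agree it is enough to check it after a reparametrisation of plots which is
the identity near a given point. -/
lemma Form.ext_local {X : Type*} [DiffeologicalSpace X] {a b : Form k X}
    (h : ∀ (n : ℕ) (p : Euc n → X), IsPlot p → ∀ t, ∃ g : Euc n → Euc n, g =ᶠ[𝓝 t] id ∧
      ∃ hpg : IsPlot (p ∘ g), a.eval (p ∘ g) hpg t = b.eval (p ∘ g) hpg t) : a = b := by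
  refine Form.ext_eval fun n p hp t => ?_
  obtain ⟨g, hg, hpg, hab⟩ := h n p hp t
  have e : p ∘ g =ᶠ[𝓝 t] p := hg.mono fun s hs => by simp [hs]
  rwa [a.eval_congr hpg hp e, b.eval_congr hpg hp e] at hab

lemma U1Bundle.isSubduction_families (P : U1Bundle A) (hA : IsSmoothlyRegular A)
    (hf : ∀ i, DSmooth (f i)) : IsSubduction (fun x : P.Families f => x.1.1) := by
  refine ⟨dSmooth_fst.comp dSmooth_val, fun n p hp t => ?_⟩
  obtain ⟨g, hg, hgt, e, he, hep⟩ :=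
    (P.isSubduction hA).exists_lifts (fun i => hf i n p hp) t
  refine ⟨fun s => ⟨(p (g s), fun i => e i s), fun i => hep i s⟩,
    ⟨isPlot_reparam hp hg, he⟩, ?_⟩
  filter_upwards [hgt] with s hs
  simp [hs]

omit [Fintype ι] in
lemma U1Bundle.isPlot_families {b : Euc n → B} (hb : IsPlot b)
    {p : ι → Euc n → P.Total} (hp : ∀ i, IsPlot (p i)) (h : ∀ i t, P.proj (p i t) = f i (b t)) :
    IsPlot (fun t => (⟨(b t, fun i => p i t), fun i => h i t⟩ : P.Families f)) := ⟨hb, hp⟩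

omit [Fintype ι] in
lemma U1Bundle.isPlot_families_apply {q : Euc n → P.Families f} (hq : IsPlot q) (i : ι) :
    IsPlot (fun t => (q t).1.2 i) := hq.2 i

lemma TensorSection.isPlot_eval (s : TensorSection P f ε) {b : Euc n → B} (hb : IsPlot b)
    {p : ι → Euc n → P.Total} (hp : ∀ i, IsPlot (p i)) (h : ∀ i t, P.proj (p i t) = f i (b t)) :
    IsPlot (fun t => s.eval (b t) (fun i => p i t) fun i => h i t) :=
  s.smooth n (fun t => ⟨(b t, fun i => p i t), fun i => h i t⟩) (U1Bundle.isPlot_families hb hp h)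

lemma TensorSection.pullsBackTo_iff (s : TensorSection P f ε) {w : Form 1 P.Total}
    {η : Form 1 B} : s.PullsBackTo w η ↔ ∀ (n : ℕ) (b : Euc n → B) (hb : IsPlot b)
      (p : ι → Euc n → P.Total) (hp : ∀ i, IsPlot (p i)) (h : ∀ i t, P.proj (p i t) = f i (b t))
      (t : Euc n), η.eval b hb t = ∑ i, ε i • w.eval (p i) (hp i) t +
        maurerCartan.eval (fun t => s.eval (b t) (fun i => p i t) fun i => h i t)
          (s.isPlot_eval hb hp h) t := by
  refine ⟨fun H n b hb p hp h t => ?_, fun H => Form.ext_eval fun n q hq t => ?_⟩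
  · have := congrArg (fun ζ => Form.eval ζ
      (fun t => (⟨(b t, fun i => p i t), fun i => h i t⟩ : P.Families f)) (U1Bundle.isPlot_families hb hp h) t) H
    simp only [Form.eval_add, Form.eval_sum, Form.eval_zsmul] at this
    exact this
  · simp only [Form.eval_add, Form.eval_sum, Form.eval_zsmul]
    exact H n (fun t => (q t).1.1) hq.1 (fun i t => (q t).1.2 i) hq.2 (fun i t => (q t).2 i) t

/-- The pullback of a connection along a section of a tensor product of bundles exists. -/
lemma TensorSection.exists_pullsBackTo (s : TensorSection P f ε) (hA : IsSmoothlyRegular A)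
    (hf : ∀ i, DSmooth (f i)) {w : Form 1 P.Total} (hw : P.IsConnection w) :
    ∃ η : Form 1 B, s.PullsBackTo w η := by
  -- Descent along the fibre product: replacing `p_i` by `g_i • p_i` adds `ε_i g_i^*dθ` through the
  -- connection, and the equivariance of `s` subtracts exactly the same terms.
  refine (P.isSubduction_families hA hf).exists_pullback_eq fun n q q' hq hq' h t => ?_
  have hb : ∀ t, (q t).1.1 = (q' t).1.1 := fun t => congrFun h t
  have h1 : ∀ i, ∃ g : Euc n → Circle, IsPlot g ∧
      (fun t => (q' t).1.2 i) = fun t => g t • (q t).1.2 i := fun i =>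
    P.exists_smul_eq hA (U1Bundle.isPlot_families_apply hq i) (U1Bundle.isPlot_families_apply hq' i) (funext fun t => by
      simp only [Function.comp_apply]
      rw [(q t).2 i, (q' t).2 i, hb])
  choose g hg hgq using h1
  have h2 : s.toFun ∘ q' = fun t => (s.toFun ∘ q) t * ∏ i, g i t ^ (-ε i) := funext fun t =>
    s.equivariant (q t) (q' t) (fun i => g i t) (hb t).symm fun i => congrFun (hgq i) t
  have h3 : maurerCartan.eval (s.toFun ∘ q') (s.smooth n q' hq') t =
      maurerCartan.eval (s.toFun ∘ q) (s.smooth n q hq) t +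
        ∑ i, -ε i • maurerCartan.eval (g i) (hg i) t := by
    rw [← eval_maurerCartan_prod_zpow (fun i => -ε i) hg (isPlot_circle_prod_zpow _ hg),
      ← eval_maurerCartan_mul (s.smooth n q hq) _
        (isPlot_circle_mul (s.smooth n q hq) (isPlot_circle_prod_zpow _ hg))]
    exact maurerCartan.eval_congr' _ _ h2 t
  have h4 : ∀ i, w.eval (fun t => (q' t).1.2 i) (U1Bundle.isPlot_families_apply hq' i) t =
      maurerCartan.eval (g i) (hg i) t + w.eval (fun t => (q t).1.2 i) (U1Bundle.isPlot_families_apply hq i) t := by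
    intro i
    exact (w.eval_congr' _ _ (hgq i) t).trans
      (U1Bundle.isConnection_iff.1 hw n (g i) _ (hg i) (U1Bundle.isPlot_families_apply hq i) t)
  have h5 : ∀ (r : Euc n → P.Families f) (hr : IsPlot r) (i : ι),
      (Form.pullback (fun x : P.Families f => x.1.2 i)
        ((dSmooth_apply i).comp (dSmooth_snd.comp dSmooth_val)) w).eval r hr t =
      w.eval (fun t => (r t).1.2 i) (U1Bundle.isPlot_families_apply hr i) t := fun _ _ _ => rfl
  simp only [Form.eval_add, Form.eval_sum, Form.eval_zsmul, h5, h4]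
  rw [Form.eval_pullback, Form.eval_pullback, h3]
  simp only [smul_add, Finset.sum_add_distrib, neg_smul, Finset.sum_neg_distrib]
  abel

/-- The exterior derivative of the pullback of a connection along a section is the pullback of the
curvature. -/
lemma TensorSection.PullsBackTo.d_eq {s : TensorSection P f ε} (hA : IsSmoothlyRegular A)
    (hf : ∀ i, DSmooth (f i)) {w : Form 1 P.Total} {η : Form 1 B} (h : s.PullsBackTo w η)
    {Ω : Form 2 A} (hΩ : Form.pullback P.proj P.dSmooth_proj Ω = Form.d w) :
    Form.d η = ∑ i, ε i • Form.pullback (f i) (hf i) Ω := by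
  refine (P.isSubduction_families hA hf).pullback_injective ?_
  rw [← Form.d_pullback, h, map_add, map_sum, map_sum, Form.d_pullback s.toFun, d_maurerCartan,
    map_zero, add_zero]
  refine Finset.sum_congr rfl fun i _ => ?_
  rw [map_zsmul, map_zsmul, Form.d_pullback, ← hΩ]
  congr 1
  refine Form.ext_eval fun n p hp t => ?_
  exact Ω.eval_congr' _ _ (funext fun s => (p s).2 i) t

end TensorSections


/-! ### Simplicial identities and alternating sums -/

section SimplicialSums

/-- Double alternating sums over families that satisfy the simplicial identities vanish. -/
lemma sum_altSign_smul_sum_altSign_smul {V : Type*} [AddCommGroup V] {l : ℕ}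
    (W : Fin (l + 2) → Fin (l + 1) → V)
    (h : ∀ i k : Fin (l + 1), i ≤ k → W k.succ i = W i.castSucc k) :
    ∑ j, altSign j • ∑ i, altSign i • W j i = 0 := by
  simp only [Finset.smul_sum, smul_smul]
  rw [← Finset.sum_product']
  -- The involution exchanging `(k+1, i)` and `(i, k)` for `i ≤ k` pairs equal entries of opposite
  -- sign.
  let g : Fin (l + 2) × Fin (l + 1) → Fin (l + 2) × Fin (l + 1) := fun a =>
    if h : a.2.castSucc < a.1 then (a.2.castSucc, a.1.pred (Fin.ne_zero_of_lt h))
    else (a.2.succ, a.1.castPred (Fin.ne_last_of_lt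
      (lt_of_le_of_lt (not_lt.1 h) a.2.castSucc_lt_succ)))
  have key : ∀ i k : Fin (l + 1), i ≤ k →
      g (k.succ, i) = (i.castSucc, k) ∧ g (i.castSucc, k) = (k.succ, i) := by
    intro i k hik
    have h1 : i.castSucc < k.succ := Fin.castSucc_lt_succ_iff.2 hik
    have h2 : ¬ k.castSucc < i.castSucc := not_lt.2 (Fin.castSucc_le_castSucc_iff.2 hik)
    simp [g, h1, h2]
  have cases : ∀ a : Fin (l + 2) × Fin (l + 1), ∃ i k : Fin (l + 1), i ≤ k ∧
      (a = (k.succ, i) ∨ a = (i.castSucc, k)) := by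
    rintro ⟨j, i⟩
    by_cases hji : i.castSucc < j
    · obtain ⟨k, rfl⟩ := Fin.exists_succ_eq.2 (Fin.ne_zero_of_lt hji)
      exact ⟨i, k, Fin.castSucc_lt_succ_iff.1 hji, Or.inl rfl⟩
    · obtain ⟨k, rfl⟩ := Fin.exists_castSucc_eq.2 (Fin.ne_last_of_lt
        (lt_of_le_of_lt (not_lt.1 hji) i.castSucc_lt_succ))
      exact ⟨k, i, Fin.castSucc_le_castSucc_iff.1 (not_lt.1 hji), Or.inr rfl⟩
  have sign : ∀ i k : Fin (l + 1), i ≤ k →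
      (altSign k.succ * altSign i) • W k.succ i +
        (altSign i.castSucc * altSign k) • W i.castSucc k = 0 := by
    intro i k hik
    rw [h i k hik, ← add_smul]
    have : altSign k.succ * altSign i + altSign i.castSucc * altSign k = 0 := by
      simp only [altSign, Fin.val_succ, Fin.val_castSucc]
      ring
    rw [this, zero_smul]
  refine Finset.sum_involution (fun a _ => g a) (fun a _ => ?_) (fun a _ _ => ?_)
    (fun a _ => Finset.mem_univ _) fun a _ => ?_
  · obtain ⟨i, k, hik, rfl | rfl⟩ := cases a
    · rw [(key i k hik).1]
      exact sign i k hik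
    · rw [(key i k hik).2, add_comm]
      exact sign i k hik
  · obtain ⟨i, k, hik, rfl | rfl⟩ := cases a
    · rw [(key i k hik).1]
      intro h
      exact (Fin.castSucc_lt_succ_iff.2 hik).ne (congrArg Prod.fst h)
    · rw [(key i k hik).2]
      intro h
      exact (Fin.castSucc_lt_succ_iff.2 hik).ne' (congrArg Prod.fst h)
  · obtain ⟨i, k, hik, rfl | rfl⟩ := cases a
    · simp only [(key i k hik).1, (key i k hik).2]
    · simp only [(key i k hik).1, (key i k hik).2]

/-- Both composites omit the vertices `i` and `k + 1`. This is why lifts indexed by the remaining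
vertices agree in mutually dual factors. -/
lemma succAbove_succAbove_of_le {l : ℕ} {i k : Fin (l + 2)} (h : i ≤ k) (a : Fin (l + 1)) :
    k.succ.succAbove (i.succAbove a) = i.castSucc.succAbove (k.succAbove a) := by
  rw [Fin.le_def] at h
  ext
  simp only [Fin.succAbove, Fin.lt_def, Fin.val_castSucc, Fin.val_succ]
  split_ifs <;> simp only [Fin.val_castSucc, Fin.val_succ] at * <;> omega

end SimplicialSums

/-! ### Bundle gerbe connections and curvings -/

section Gerbes

variable {Z B : Type*} [TopologicalSpace Z] [DiffeologicalSpace Z] {π : Z → B} {k : ℕ}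

lemma intCast_smul_form {X : Type*} [DiffeologicalSpace X] (c : ℤ) (a : Form k X) :
    (c : ℝ) • a = c • a := Int.cast_smul_eq_zsmul ℝ c a

omit [TopologicalSpace Z] in
lemma FibProd.coboundary_apply (l : ℕ) (η : Form k (FibProd π l)) :
    FibProd.coboundary π l η =
      ∑ i, altSign i • Form.pullback (FibProd.face π i) (FibProd.dSmooth_face π i) η := by
  simp only [FibProd.coboundary, LinearMap.sum_apply, LinearMap.smul_apply, intCast_smul_form]

lemma IsSmoothlyRegular.fibProd (hZ : IsSmoothlyRegular Z) (π : Z → B) (l : ℕ) :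
    IsSmoothlyRegular (FibProd π l) := (hZ.pi (Fin l)).subtype _

/-- Changing a connection by a form on the base. -/
lemma TensorSection.PullsBackTo.sub_pullback {A C ι : Type*} [TopologicalSpace A]
    [DiffeologicalSpace A] [DiffeologicalSpace C] [Fintype ι] {P : U1Bundle A} {f : ι → C → A}
    {ε : ι → ℤ} {s : TensorSection P f ε} {w : Form 1 P.Total} {η : Form 1 C}
    (h : s.PullsBackTo w η) (hf : ∀ i, DSmooth (f i)) (κ : Form 1 A) :
    s.PullsBackTo (w - Form.pullback P.proj P.dSmooth_proj κ)
      (η - ∑ i, ε i • Form.pullback (f i) (hf i) κ) := by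
  rw [TensorSection.pullsBackTo_iff] at h ⊢
  intro n b hb p hp hpf t
  rw [Form.eval_sub, h n b hb p hp hpf t, Form.eval_sum]
  have h1 : ∀ i, κ.eval (P.proj ∘ p i) (P.dSmooth_proj n _ (hp i)) t =
      κ.eval (f i ∘ b) (hf i n b hb) t := fun i => κ.eval_congr' _ _ (funext fun s => hpf i s) t
  simp only [Form.eval_sub, Form.eval_zsmul, Form.eval_pullback, h1, smul_sub,
    Finset.sum_sub_distrib]
  abel

/-- The pullback of a connection along the multiplication of a bundle gerbe is a cocycle. -/
lemma BundleGerbe.coboundary_eq_zero (E : BundleGerbe π) (hZ : IsSmoothlyRegular Z)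
    {w : Form 1 E.bundle.Total} {ρ : Form 1 (FibProd π 3)} (h : E.mul.PullsBackTo w ρ) :
    FibProd.coboundary π 3 ρ = 0 := by
  rw [TensorSection.pullsBackTo_iff] at h
  refine Form.ext_local fun n x hx t => ?_
  -- Lifts to `E` are chosen once per pair of the four points, not once per pair of faces. Dual
  -- factors of `δ²E` then automatically receive the same representative, as `E.assoc` requires.
  let c : Fin 4 × Fin 4 → Euc n → FibProd π 2 := fun a s =>
    ⟨![(x s).1 a.1, (x s).1 a.2], fun _ _ => by
      rw [show ∀ i, π (![(x s).1 a.1, (x s).1 a.2] i) = π ((x s).1 0) from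
        Fin.forall_fin_two.2 ⟨(x s).2 _ _, (x s).2 _ _⟩,
        show ∀ i, π (![(x s).1 a.1, (x s).1 a.2] i) = π ((x s).1 0) from
        Fin.forall_fin_two.2 ⟨(x s).2 _ _, (x s).2 _ _⟩]⟩
  have hc : ∀ a, IsPlot (c a) := fun a => by
    refine Fin.forall_fin_two.2 ⟨?_, ?_⟩
    · exact hx a.1
    · exact hx a.2
  obtain ⟨g, hg, hgt, e, he, hec⟩ :=
    (E.bundle.isSubduction (hZ.fibProd π 2)).exists_lifts hc t
  have hxg : IsPlot (x ∘ g) := isPlot_reparam hx hg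
  refine ⟨g, hgt, hxg, ?_⟩
  let p : Fin 4 → Fin 3 → Euc n → E.bundle.Total := fun j i =>
    e (j.succAbove (i.succAbove 0), j.succAbove (i.succAbove 1))
  have hp : ∀ j i, IsPlot (p j i) := fun j i => he _
  have hpf : ∀ j i s, E.bundle.proj (p j i s) = FibProd.face π i (FibProd.face π j (x (g s))) := by
    intro j i s
    rw [hec]
    exact Subtype.ext (funext (Fin.forall_fin_two.2 ⟨rfl, rfl⟩))
  have hpp : ∀ i k : Fin 3, i ≤ k → p k.succ i = p i.castSucc k := by
    intro i k hik
    simp only [p, succAbove_succAbove_of_le hik]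
  have hface : ∀ j : Fin 4, IsPlot (FibProd.face π j ∘ x ∘ g) := fun j =>
    FibProd.dSmooth_face π j n _ hxg
  let S : Fin 4 → Euc n → Circle := fun j s =>
    E.mul.eval (FibProd.face π j (x (g s))) (fun i => p j i s) fun i => hpf j i s
  have hS : ∀ j, IsPlot (S j) := fun j => E.mul.isPlot_eval (hface j) (hp j) (hpf j)
  have h1 : ∀ j : Fin 4, ρ.eval (FibProd.face π j ∘ x ∘ g) (hface j) t =
      ∑ i, altSign i • w.eval (p j i) (hp j i) t + maurerCartan.eval (S j) (hS j) t := fun j =>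
    h n _ (hface j) (p j) (hp j) (hpf j) t
  -- Associativity says that the alternating product of the `S j` is `1`, so their Maurer–Cartan
  -- terms cancel; only a double alternating sum of values of `w` is left.
  have h2 : ∑ j : Fin 4, altSign j • maurerCartan.eval (S j) (hS j) t = 0 := by
    rw [← eval_maurerCartan_prod_zpow altSign hS (isPlot_circle_prod_zpow altSign hS),
      ← eval_maurerCartan_one isPlot_const t]
    refine maurerCartan.eval_congr' _ _ (funext fun s => ?_) t
    exact E.assoc (x (g s)) (fun j i => p j i s) (fun j i => hpf j i s)
      fun i k hik => congrFun (hpp i k hik) s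
  rw [FibProd.coboundary_apply, Form.eval_sum]
  simp only [Form.eval_zsmul, Form.eval_pullback, h1, smul_add, Finset.sum_add_distrib, h2,
    add_zero, Form.eval_zero]
  exact sum_altSign_smul_sum_altSign_smul (fun j i => w.eval (p j i) (hp j i) t)
    fun i k hik => w.eval_congr' _ _ (hpp i k hik) t

/-- Bundle gerbe connections and curvings exist. -/
theorem BundleGerbe.exists_isCurving [TopologicalSpace B] [DiffeologicalSpace B]
    (E : BundleGerbe π) (hZ : IsSmoothlyRegular Z)
    (hB : IsSmoothlyRegular B) (hπ : HasLocalSections π) :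
    ∃ (w : Form 1 E.bundle.Total) (b : Form 2 Z), E.IsConnection w ∧ E.IsCurving w b := by
  have hf : ∀ i : Fin 3, DSmooth (FibProd.face π (k := 2) i) := FibProd.dSmooth_face π
  obtain ⟨w, hw⟩ := E.bundle.exists_isConnection (hZ.fibProd π 2)
  obtain ⟨ρ, hρ⟩ := E.mul.exists_pullsBackTo (hZ.fibProd π 2) hf hw
  -- The failure `ρ` of `w` to be a gerbe connection is a cocycle, and its primitive is the
  -- correction. The curvature of the corrected connection is a cocycle in turn, being tied to `d 0`
  -- through the multiplication, and its primitive is the curving.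
  obtain ⟨κ, hκ⟩ := FibProd.exists_coboundary_eq hB hπ 1 ρ (E.coboundary_eq_zero hZ hρ)
  let w' := w - Form.pullback E.bundle.proj E.bundle.dSmooth_proj κ
  have hw' : E.bundle.IsConnection w' := hw.sub_pullback κ
  have hmul : E.mul.PullsBackTo w' 0 := by
    have := hρ.sub_pullback hf κ
    rwa [← FibProd.coboundary_apply, hκ, sub_self] at this
  obtain ⟨Ω, hΩ⟩ := hw'.exists_curvature (hZ.fibProd π 2)
  have hΩ0 : FibProd.coboundary π 2 Ω = 0 := by
    rw [FibProd.coboundary_apply, ← hmul.d_eq (hZ.fibProd π 2) hf hΩ, map_zero]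
  obtain ⟨b, hb⟩ := exists_delta_eq hB hπ Ω hΩ0
  exact ⟨w', b, ⟨hw', hmul⟩, by rw [BundleGerbe.IsCurving, hb, hΩ]⟩

end Gerbes


/-! ### Forms on simplicial submersions -/

section SimplicialForms

variable {X : Type*} [TopologicalSpace X] [DiffeologicalSpace X] {k : ℕ}

lemma d_delta {A B : Type*} [DiffeologicalSpace A] (π : A → B) (η : Form k A) :
    Form.d (delta π η) = delta π (Form.d η) := by
  simp only [delta, LinearMap.sub_apply, map_sub, Form.d_pullback]

namespace SimplicialSubmersion

variable (S : SimplicialSubmersion X)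

lemma dSmooth_face (n : ℕ) (hn : n + 1 ≤ 3) (i : Fin (n + 2)) : DSmooth (S.face n hn i) :=
  S.dSmooth_map _ hn _

lemma dSmooth_hface (n l : ℕ) (hn : n + 1 ≤ 3) (i : Fin (n + 2)) : DSmooth (S.hface n l hn i) :=
  fun m _ hp j => S.dSmooth_face n hn i m _ (hp j)

lemma isSmoothlyRegular_Y : IsSmoothlyRegular S.Y := S.manifoldY.isSmoothlyRegular

lemma isSmoothlyRegular_Z {n : ℕ} (hn : n ≤ 3) : IsSmoothlyRegular (S.Z n) :=
  (S.manifoldZ n hn).isSmoothlyRegular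

lemma isSubduction_πZ {n : ℕ} (hn : n ≤ 3) : IsSubduction (S.πZ n) :=
  (S.submersionZ n hn).hasLocalSections.isSubduction (S.isSmoothlyRegular_Y.fibProd S.π (n + 1))

lemma isSubduction_π (hX : IsSmoothManifold X) : IsSubduction S.π :=
  S.submersion.hasLocalSections.isSubduction hX.isSmoothlyRegular

lemma isSubduction_π₀ : IsSubduction S.π₀ := by
  refine ⟨S.dSmooth_π₀, fun n p hp t => ?_⟩
  obtain ⟨q, hq, hqt⟩ := (S.isSubduction_πZ (Nat.zero_le 3)).exists_lift n
    (fun s => ⟨fun _ => p s, fun _ _ => rfl⟩) (fun _ => hp) t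
  refine ⟨q, hq, ?_⟩
  filter_upwards [hqt] with s hs
  exact congrArg (fun a : FibProd S.π 1 => a.1 0) hs

/-- The vertical direction on `Z_0` is taken over `Y^{[1]}`; equality of points of `Y` suffices for
equality there, so closed forms descend to `Y` itself. -/
lemma isBasic_π₀_of_delta_eq_zero {η : Form k (S.Z 0)} (h : delta (S.πZ 0) η = 0) :
    η.IsBasic S.π₀ := fun n q q' hq hq' hqq' t =>
  isBasic_of_delta_eq_zero h n q q' hq hq' (funext fun s => Subtype.ext (funext fun i => by
    obtain rfl : i = 0 := Subsingleton.elim (α := Fin 1) _ _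
    exact congrFun hqq' s)) t

lemma delta_pullback_π₀ (ζ : Form k S.Y) :
    delta (S.πZ 0) (Form.pullback S.π₀ S.dSmooth_π₀ ζ) = 0 := by
  have hπ : DSmooth (fun a : FibProd S.π 1 => a.1 0) := FibProd.dSmooth_pr S.π 0
  exact delta_pullback_eq_zero (S.submersionZ 0 (Nat.zero_le 3)).smooth (Form.pullback _ hπ ζ)

lemma deltaH_apply (n : ℕ) (hn : n + 1 ≤ 3) (η : Form k (S.Z n)) :
    S.deltaH n hn η =
      ∑ i, altSign i • Form.pullback (S.face n hn i) (S.dSmooth_face n hn i) η := by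
  simp only [deltaH, LinearMap.sum_apply, LinearMap.smul_apply, intCast_smul_form]

lemma d_deltaH (n : ℕ) (hn : n + 1 ≤ 3) (η : Form k (S.Z n)) :
    Form.d (S.deltaH n hn η) = S.deltaH n hn (Form.d η) := by
  simp only [deltaH_apply, map_sum, map_zsmul, Form.d_pullback]

lemma face_face (n : ℕ) (hn : n + 2 ≤ 3) {i j : Fin (n + 2)} (h : i ≤ j) (z : S.Z (n + 2)) :
    S.face n (by omega) i (S.face (n + 1) hn j.succ z) =
      S.face n (by omega) j (S.face (n + 1) hn i.castSucc z) := by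
  simp only [face]
  rw [← S.map_comp, ← S.map_comp]
  congr 1
  ext a
  exact congrArg Fin.val (succAbove_succAbove_of_le h a)

lemma deltaH_deltaH (n : ℕ) (hn : n + 2 ≤ 3) (η : Form k (S.Z n)) :
    S.deltaH (n + 1) hn (S.deltaH n (by omega) η) = 0 := by
  refine Form.ext_eval fun m z hz t => ?_
  simp only [deltaH_apply, Form.eval_sum, Form.eval_zsmul, Form.eval_pullback, Form.eval_zero]
  exact sum_altSign_smul_sum_altSign_smul (fun j i => η.eval (S.face n (by omega) i ∘
      S.face (n + 1) hn j ∘ z) (S.dSmooth_face n _ i m _ (S.dSmooth_face (n + 1) hn j m z hz)) t)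
    fun i j hij => η.eval_congr' _ _ (funext fun s => S.face_face n hn hij (z s)) t

lemma delta_deltaH (n : ℕ) (hn : n + 1 ≤ 3) (η : Form k (S.Z n)) :
    delta (S.πZ (n + 1)) (S.deltaH n hn η) = ∑ i, altSign i •
      Form.pullback (S.hface n 2 hn i) (S.dSmooth_hface n 2 hn i) (delta (S.πZ n) η) := by
  refine Form.ext_eval fun m z hz t => ?_
  simp only [FibProd.eval_delta, deltaH_apply, Form.eval_sum, Form.eval_zsmul, Form.eval_pullback,
    ← Finset.sum_sub_distrib]
  exact Finset.sum_congr rfl fun i _ => (smul_sub _ _ _).symm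

lemma pullback_coboundary (n : ℕ) (hn : n + 1 ≤ 3) (η : Form k (FibProd S.π (n + 1))) :
    Form.pullback (S.πZ (n + 1)) (S.submersionZ _ hn).smooth (FibProd.coboundary S.π (n + 1) η) =
      S.deltaH n hn (Form.pullback (S.πZ n) (S.submersionZ n (by omega)).smooth η) := by
  rw [FibProd.coboundary_apply, deltaH_apply, map_sum]
  refine Finset.sum_congr rfl fun i _ => ?_
  rw [map_zsmul]
  congr 1
  refine Form.ext_eval fun m z hz t => η.eval_congr' _ _ (funext fun s => ?_) t
  exact Subtype.ext (funext fun a =>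
    (S.πZ_map (by omega) hn (Fin.succAboveOrderEmb i).toOrderHom (z s) a).symm)

/-- The lowest degree of `pullback_coboundary`, with `Y` in place of `Y^{[1]}`. Face `i` of a
1-simplex keeps the vertex `1 - i`, which matches the order of the terms in `delta`. -/
lemma pullback_delta (ζ : Form k S.Y) :
    Form.pullback (S.πZ 1) (S.submersionZ 1 (by norm_num)).smooth (delta S.π ζ) =
      S.deltaH 0 (by norm_num) (Form.pullback S.π₀ S.dSmooth_π₀ ζ) := by
  rw [deltaH_apply, Fin.sum_univ_two]
  refine Form.ext_eval fun m z hz t => ?_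
  have h : ∀ i : Fin 2, (Form.pullback (S.face 0 (by norm_num) i) (S.dSmooth_face 0 _ i)
      (Form.pullback S.π₀ S.dSmooth_π₀ ζ)).eval z hz t =
      (Form.pullback (FibProd.pr S.π (i.succAbove 0)) (FibProd.dSmooth_pr S.π _) ζ).eval
        (S.πZ 1 ∘ z) ((S.submersionZ 1 (by norm_num)).smooth m z hz) t := fun i =>
    ζ.eval_congr' _ _ (funext fun s =>
      S.πZ_map (by omega) (by omega) (Fin.succAboveOrderEmb i).toOrderHom (z s) 0) t
  simp only [Form.eval_add, Form.eval_zsmul, h, altSign]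
  simp only [Fin.val_zero, pow_zero, one_smul, Fin.val_one, pow_one, neg_smul]
  exact sub_eq_add_neg _ _

end SimplicialSubmersion

end SimplicialForms


/-! ### Trivialisations of rigid bundle 2-gerbes -/

section Trivialisations

variable {X : Type*} [TopologicalSpace X] [DiffeologicalSpace X] {G : RigidBundleTwoGerbe X}
  {T : RigidTrivialisation G} {wE : Form 1 G.E.bundle.Total} {wF : Form 1 T.F.bundle.Total}
  {η : Form 1 G.E.bundle.Total}

lemma RigidTrivialisation.dSmooth_hface_proj (G : RigidBundleTwoGerbe X) (i : Fin 2) :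
    DSmooth (fun e : G.E.bundle.Total => G.hface 0 2 (by norm_num) i (G.E.bundle.proj e)) :=
  (G.dSmooth_hface 0 2 _ i).comp G.E.bundle.dSmooth_proj

/-- The pullback of a connection on `δ_h F` along the isomorphism `t : E → δ_h F` is a connection
on `E`. -/
lemma RigidTrivialisation.isConnection_of_pullsBackTo
    (hη : T.t.PullsBackTo wF η) : G.E.bundle.IsConnection η := by
  rw [TensorSection.pullsBackTo_iff] at hη
  have hr : ∀ (g : Circle) (e : G.E.bundle.Total) (i : Fin 2),
      G.hface 0 2 (by norm_num) i (G.E.bundle.proj (g • e)) =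
        G.hface 0 2 (by norm_num) i (G.E.bundle.proj e) := fun g e i => by
    rw [G.E.bundle.proj_smul]
  refine U1Bundle.isConnection_iff.2 fun n g e hg he t => ?_
  obtain ⟨r, hr', hrt⟩ := (T.F.bundle.isSubduction_families
    ((G.isSmoothlyRegular_Z (Nat.zero_le 3)).fibProd _ 2)
    (RigidTrivialisation.dSmooth_hface_proj G)).exists_lift n e he t
  let e' : Euc n → G.E.bundle.Total := fun s => (r s).1.1
  have he' : IsPlot e' := hr'.1
  let p : Fin 2 → Euc n → T.F.bundle.Total := fun i s => (r s).1.2 i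
  have hp : ∀ i, IsPlot (p i) := fun i => U1Bundle.isPlot_families_apply hr' i
  have hpf : ∀ i s, T.F.bundle.proj (p i s) =
      G.hface 0 2 (by norm_num) i (G.E.bundle.proj (e' s)) := fun i s => (r s).2 i
  -- The same representatives in `F` serve for `e'` and for `g • e'`, as the two have one
  -- projection; only the value of `t` changes, by the factor `g`.
  have hpf' : ∀ i s, T.F.bundle.proj (p i s) =
      G.hface 0 2 (by norm_num) i (G.E.bundle.proj (g s • e' s)) := fun i s => by
    rw [hr, hpf]
  have hge : (fun s => g s • e' s) =ᶠ[𝓝 t] fun s => g s • e s := by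
    filter_upwards [hrt] with s hs
    rw [← hs]
    rfl
  rw [← η.eval_congr (G.E.bundle.isPlot_smul hg he') (G.E.bundle.isPlot_smul hg he) hge,
    ← η.eval_congr he' he hrt, hη n _ (G.E.bundle.isPlot_smul hg he') p hp hpf' t,
    hη n e' he' p hp hpf t, add_left_comm, ← eval_maurerCartan_mul hg (T.t.isPlot_eval he' hp hpf)
      (isPlot_circle_mul hg (T.t.isPlot_eval he' hp hpf))]
  congr 1
  exact maurerCartan.eval_congr' _ _ (funext fun s =>
    T.t_equivariant (g s) (e' s) (fun i => p i s) (fun i => hpf i s) fun i => hpf' i s) t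

/-- The linear algebra of `RigidTrivialisation.coboundary_eq_zero`. `E`, `η`, `F` stand for the
values of `∇_E`, `t^*δ_h∇_F`, `∇_F` on chosen lifts, and `m`, `t`, `m'` for the Maurer–Cartan terms
of `m_E`, `t`, `m_F`; `h4` is the logarithmic derivative of `t_mul`. The two double sums of `F`
cancel after exchanging the order of summation. -/
lemma altSum_sub_eq_zero {V : Type*} [AddCommGroup V] (E η t : Fin 3 → V) (F : Fin 3 → Fin 2 → V)
    (m : V) (m' : Fin 2 → V) (h1 : 0 = ∑ i, altSign i • E i + m)
    (h2 : ∀ i, η i = ∑ j, altSign j • F i j + t i)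
    (h3 : ∀ j, 0 = ∑ i, altSign i • F i j + m' j)
    (h4 : m + ∑ i, altSign i • t i = ∑ j, altSign j • m' j) :
    ∑ i, altSign i • (E i - η i) = 0 := by
  have h5 : ∀ j, m' j = -∑ i, altSign i • F i j := fun j => eq_neg_of_add_eq_zero_right (h3 j).symm
  have h6 : ∑ i, altSign i • E i = -m := eq_neg_of_add_eq_zero_left h1.symm
  have h7 : ∑ i, altSign i • t i = ∑ j, altSign j • m' j - m := eq_sub_of_add_eq' h4
  simp only [smul_sub, Finset.sum_sub_distrib, h2, smul_add, Finset.sum_add_distrib, h6, h7, h5,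
    smul_neg, Finset.sum_neg_distrib, Finset.smul_sum]
  rw [Finset.sum_comm]
  simp only [smul_comm (altSign (_ : Fin 3)) (altSign (_ : Fin 2))]
  abel

/-- The difference `∇_E - t^*δ_h∇_F` is a vertical cocycle. -/
lemma RigidTrivialisation.coboundary_eq_zero
    (hE : G.E.IsConnection wE) (hF : T.F.IsConnection wF) (hη : T.t.PullsBackTo wF η)
    {κ : Form 1 (G.Fib 1 2)}
    (hκ : Form.pullback G.E.bundle.proj G.E.bundle.dSmooth_proj κ = wE - η) :
    FibProd.coboundary (G.πZ 1) 2 κ = 0 := by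
  have hE := (TensorSection.pullsBackTo_iff _).1 hE.2
  have hF := (TensorSection.pullsBackTo_iff _).1 hF.2
  have hη := (TensorSection.pullsBackTo_iff _).1 hη
  have hv : ∀ i, DSmooth (G.vface 1 2 i) := fun i => FibProd.dSmooth_face _ i
  refine Form.ext_local fun n z₀ hz₀ t => ?_
  -- Lifts to `E` over the vertical faces come before lifts to `F` over the horizontal faces of
  -- those. Each choice shrinks the plot, hence the reparametrisation `g₁ ∘ g₂`.
  obtain ⟨g₁, hg₁, hgt₁, e₀, he₀, hev₀⟩ := (G.E.bundle.isSubduction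
    ((G.isSmoothlyRegular_Z (n := 1) (by norm_num)).fibProd _ 2)).exists_lifts
    (fun i => hv i n z₀ hz₀) t
  obtain ⟨g₂, hg₂, hgt₂, f', hf', hff'⟩ := (T.F.bundle.isSubduction
    ((G.isSmoothlyRegular_Z (Nat.zero_le 3)).fibProd _ 2)).exists_lifts
    (fun a : Fin 3 × Fin 2 => G.dSmooth_hface 0 2 (by norm_num) a.2 n _
      (hv a.1 n _ (isPlot_reparam hz₀ hg₁))) t
  let z : Euc n → G.Fib 1 3 := z₀ ∘ (g₁ ∘ g₂)
  have hz : IsPlot z := isPlot_reparam hz₀ (hg₁.comp hg₂)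
  let e : Fin 3 → Euc n → G.E.bundle.Total := fun i => e₀ i ∘ g₂
  have he : ∀ i, IsPlot (e i) := fun i => isPlot_reparam (he₀ i) hg₂
  have hev : ∀ i s, G.E.bundle.proj (e i s) = G.vface 1 2 i (z s) := fun i s => hev₀ i (g₂ s)
  let f : Fin 3 → Fin 2 → Euc n → T.F.bundle.Total := fun i j => f' (i, j)
  have hf : ∀ i j, IsPlot (f i j) := fun i j => hf' (i, j)
  have hfv : ∀ i j s, T.F.bundle.proj (f i j s) =
      G.hface 0 2 (by norm_num) j (G.vface 1 2 i (z s)) := fun i j s => hff' (i, j) s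
  have hfe : ∀ i j s, T.F.bundle.proj (f i j s) =
      G.hface 0 2 (by norm_num) j (G.E.bundle.proj (e i s)) := fun i j s => by rw [hfv, hev]
  have hfh : ∀ j i s, T.F.bundle.proj (f i j s) =
      G.vface 0 2 i (G.hface 0 3 (by norm_num) j (z s)) := fun j i s => hfv i j s
  have hgt : g₁ ∘ g₂ =ᶠ[𝓝 t] id := by
    have h1 : Tendsto g₂ (𝓝 t) (𝓝 t) := by
      simpa [hgt₂.eq_of_nhds] using (hg₂.continuous.continuousAt (x := t)).tendsto
    filter_upwards [hgt₂, h1.eventually hgt₁] with s hs hs'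
    simpa [hs] using hs'
  refine ⟨g₁ ∘ g₂, hgt, hz, ?_⟩
  have hhz : ∀ j, IsPlot (fun s => G.hface 0 3 (by norm_num) j (z s)) := fun j =>
    G.dSmooth_hface 0 3 (by norm_num) j n z hz
  let mE : Euc n → Circle := fun s => G.E.mul.eval (z s) (fun i => e i s) fun i => hev i s
  have hmE : IsPlot mE := G.E.mul.isPlot_eval hz he hev
  let mF : Fin 2 → Euc n → Circle := fun j s => T.F.mul.eval (G.hface 0 3 (by norm_num) j (z s))
    (fun i => f i j s) fun i => hfh j i s
  have hmF : ∀ j, IsPlot (mF j) := fun j =>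
    T.F.mul.isPlot_eval (hhz j) (fun i => hf i j) (hfh j)
  let tt : Fin 3 → Euc n → Circle := fun i s => T.t.eval (e i s) (fun j => f i j s)
    fun j => hfe i j s
  have htt : ∀ i, IsPlot (tt i) := fun i => T.t.isPlot_eval (he i) (hf i) (hfe i)
  have h1 : 0 = ∑ i, altSign i • wE.eval (e i) (he i) t + maurerCartan.eval mE hmE t :=
    hE n z hz e he hev t
  have h2 : ∀ i, η.eval (e i) (he i) t = ∑ j, altSign j • wF.eval (f i j) (hf i j) t +
      maurerCartan.eval (tt i) (htt i) t := fun i => hη n (e i) (he i) (f i) (hf i) (hfe i) t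
  have h3 : ∀ j, 0 = ∑ i, altSign i • wF.eval (f i j) (hf i j) t +
      maurerCartan.eval (mF j) (hmF j) t := fun j =>
    hF n _ (hhz j) (fun i => f i j) (fun i => hf i j) (hfh j) t
  have h4 : maurerCartan.eval mE hmE t + ∑ i, altSign i • maurerCartan.eval (tt i) (htt i) t =
      ∑ j, altSign j • maurerCartan.eval (mF j) (hmF j) t := by
    rw [← eval_maurerCartan_prod_zpow altSign htt (isPlot_circle_prod_zpow altSign htt),
      ← eval_maurerCartan_prod_zpow altSign hmF (isPlot_circle_prod_zpow altSign hmF),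
      ← eval_maurerCartan_mul hmE _
        (isPlot_circle_mul hmE (isPlot_circle_prod_zpow altSign htt))]
    exact maurerCartan.eval_congr' _ _ (funext fun s =>
      T.t_mul (z s) (fun i => e i s) (fun i j => f i j s) (fun i => hev i s)
        (fun i j => hfe i j s) fun j i => hfh j i s) t
  have h5 : ∀ i : Fin 3, κ.eval (FibProd.face (G.πZ 1) i ∘ z) (hv i n z hz) t =
      wE.eval (e i) (he i) t - η.eval (e i) (he i) t := fun i => by
    rw [← Form.eval_sub, ← hκ, Form.eval_pullback]
    exact κ.eval_congr' _ _ (funext fun s => (hev i s).symm) t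
  rw [FibProd.coboundary_apply, Form.eval_sum]
  refine Eq.trans ?_ (altSum_sub_eq_zero _ _ _ (fun i j => wF.eval (f i j) (hf i j) t) _ _
    h1 h2 h3 h4)
  refine Finset.sum_congr rfl fun i _ => ?_
  rw [Form.eval_zsmul, ← h5]
  rfl

/-- The map induced on fibre powers by a vertex of the simplex. -/
def SimplicialSubmersion.vertex (S : SimplicialSubmersion X) (v : Fin 3) (z : S.Fib 2 2) :
    S.Fib 0 2 :=
  ⟨fun l => S.map (Nat.zero_le 3) (by norm_num) ⟨fun _ => v, fun _ _ _ => le_rfl⟩ (z.1 l),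
    fun l l' => Subtype.ext (funext fun j => by rw [S.πZ_map, S.πZ_map, z.2 l l'])⟩

lemma SimplicialSubmersion.dSmooth_vertex (S : SimplicialSubmersion X) (v : Fin 3) :
    DSmooth (S.vertex v) := fun m _ hp l => S.dSmooth_map _ _ _ m _ (hp l)

/-- Two successive faces of a 2-simplex leave a single vertex, so three lifts to `F`, one per
vertex, cover all six factors of `δ_h²F`. -/
lemma SimplicialSubmersion.hface_hface_eq_vertex (S : SimplicialSubmersion X) (i : Fin 3)
    (j : Fin 2) (z : S.Fib 2 2) :
    S.hface 0 2 (by norm_num) j (S.hface 1 2 (by norm_num) i z) =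
      S.vertex (i.succAbove (j.succAbove 0)) z := by
  refine Subtype.ext (funext fun l => ?_)
  change S.map _ _ _ (S.map _ _ _ _) = S.map _ _ _ _
  rw [← S.map_comp]
  congr 1
  ext a
  obtain rfl : a = 0 := Subsingleton.elim (α := Fin 1) _ _
  rfl

/-- The vertical coboundary of `δ_h a` is that of `α`. -/
lemma RigidTrivialisation.delta_deltaH_sub_eq_zero
    {α : Form 1 (G.Z 2)} (hα : G.M.PullsBackTo wE (delta (G.πZ 2) α))
    (hη : T.t.PullsBackTo wF η) {a : Form 1 (G.Z 1)}
    (ha : Form.pullback G.E.bundle.proj G.E.bundle.dSmooth_proj (delta (G.πZ 1) a) = wE - η) :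
    delta (G.πZ 2) (G.deltaH 1 (by norm_num) a - α) = 0 := by
  have hα := (TensorSection.pullsBackTo_iff _).1 hα
  have hη := (TensorSection.pullsBackTo_iff _).1 hη
  rw [map_sub, SimplicialSubmersion.delta_deltaH]
  have hh : ∀ i, DSmooth (G.hface 1 2 (by norm_num) i) := G.dSmooth_hface 1 2 (by norm_num)
  refine Form.ext_local fun n z₀ hz₀ t => ?_
  obtain ⟨g₁, hg₁, hgt₁, e₀, he₀, hev₀⟩ := (G.E.bundle.isSubduction
    ((G.isSmoothlyRegular_Z (n := 1) (by norm_num)).fibProd _ 2)).exists_lifts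
    (fun i => hh i n z₀ hz₀) t
  obtain ⟨g₂, hg₂, hgt₂, L, hL, hLv⟩ := (T.F.bundle.isSubduction
    ((G.isSmoothlyRegular_Z (Nat.zero_le 3)).fibProd _ 2)).exists_lifts
    (fun v => G.dSmooth_vertex v n _ (isPlot_reparam hz₀ hg₁)) t
  let z : Euc n → G.Fib 2 2 := z₀ ∘ (g₁ ∘ g₂)
  have hz : IsPlot z := isPlot_reparam hz₀ (hg₁.comp hg₂)
  let e : Fin 3 → Euc n → G.E.bundle.Total := fun i => e₀ i ∘ g₂
  have he : ∀ i, IsPlot (e i) := fun i => isPlot_reparam (he₀ i) hg₂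
  have hev : ∀ i s, G.E.bundle.proj (e i s) = G.hface 1 2 (by norm_num) i (z s) :=
    fun i s => hev₀ i (g₂ s)
  -- Indexing by the surviving vertex makes the representatives in dual factors equal, the
  -- hypothesis under which `t_M` applies.
  let f : Fin 3 → Fin 2 → Euc n → T.F.bundle.Total := fun i j => L (i.succAbove (j.succAbove 0))
  have hf : ∀ i j, IsPlot (f i j) := fun i j => hL _
  have hfe : ∀ i j s, T.F.bundle.proj (f i j s) =
      G.hface 0 2 (by norm_num) j (G.E.bundle.proj (e i s)) := fun i j s => by
    rw [hev, SimplicialSubmersion.hface_hface_eq_vertex]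
    exact hLv _ s
  have hff : ∀ j k : Fin 2, j ≤ k → f k.succ j = f j.castSucc k := fun j k hjk => by
    simp only [f, succAbove_succAbove_of_le hjk]
  have hgt : g₁ ∘ g₂ =ᶠ[𝓝 t] id := by
    have h1 : Tendsto g₂ (𝓝 t) (𝓝 t) := by
      simpa [hgt₂.eq_of_nhds] using (hg₂.continuous.continuousAt (x := t)).tendsto
    filter_upwards [hgt₂, h1.eventually hgt₁] with s hs hs'
    simpa [hs] using hs'
  refine ⟨g₁ ∘ g₂, hgt, hz, ?_⟩
  let mM : Euc n → Circle := fun s => G.M.eval (z s) (fun i => e i s) fun i => hev i s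
  have hmM : IsPlot mM := G.M.isPlot_eval hz he hev
  let tt : Fin 3 → Euc n → Circle := fun i s => T.t.eval (e i s) (fun j => f i j s)
    fun j => hfe i j s
  have htt : ∀ i, IsPlot (tt i) := fun i => T.t.isPlot_eval (he i) (hf i) (hfe i)
  have h1 : (delta (G.πZ 2) α).eval z hz t =
      ∑ i, altSign i • wE.eval (e i) (he i) t + maurerCartan.eval mM hmM t :=
    hα n z hz e he hev t
  have h2 : ∀ i, η.eval (e i) (he i) t = ∑ j, altSign j • wF.eval (f i j) (hf i j) t +
      maurerCartan.eval (tt i) (htt i) t := fun i => hη n (e i) (he i) (f i) (hf i) (hfe i) t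
  have h3 : maurerCartan.eval mM hmM t +
      ∑ i, altSign i • maurerCartan.eval (tt i) (htt i) t = 0 := by
    rw [← eval_maurerCartan_prod_zpow altSign htt (isPlot_circle_prod_zpow altSign htt),
      ← eval_maurerCartan_mul hmM _
        (isPlot_circle_mul hmM (isPlot_circle_prod_zpow altSign htt)),
      ← eval_maurerCartan_one isPlot_const t]
    exact maurerCartan.eval_congr' _ _ (funext fun s =>
      T.t_M (z s) (fun i => e i s) (fun i j => f i j s) (fun i => hev i s)
        (fun i j => hfe i j s) fun j k hjk => congrFun (hff j k hjk) s) t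
  have h4 : ∑ i, altSign i • ∑ j, altSign j • wF.eval (f i j) (hf i j) t = 0 :=
    sum_altSign_smul_sum_altSign_smul (fun i j => wF.eval (f i j) (hf i j) t)
      fun j k hjk => wF.eval_congr' _ _ (hff j k hjk) t
  have h5 : ∀ i : Fin 3, (delta (G.πZ 1) a).eval (G.hface 1 2 (by norm_num) i ∘ z)
      (hh i n z hz) t = wE.eval (e i) (he i) t - η.eval (e i) (he i) t := fun i => by
    rw [← Form.eval_sub, ← ha, Form.eval_pullback]
    exact (delta (G.πZ 1) a).eval_congr' _ _ (funext fun s => (hev i s).symm) t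
  have h6 : (∑ i, altSign i • Form.pullback (G.hface 1 2 (by norm_num) i) (hh i)
      (delta (G.πZ 1) a)).eval z hz t = ∑ i, altSign i •
        (wE.eval (e i) (he i) t - η.eval (e i) (he i) t) := by
    rw [Form.eval_sum]
    refine Finset.sum_congr rfl fun i _ => ?_
    rw [Form.eval_zsmul, ← h5]
    rfl
  change (∑ i, altSign i • Form.pullback (G.hface 1 2 (by norm_num) i) (hh i)
      (delta (G.πZ 1) a)).eval z hz t - (delta (G.πZ 2) α).eval z hz t = 0
  -- The `∇_E` terms cancel between `δ_h δ_v a` and `δ_v α`. What remains is a double alternating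
  -- sum of `∇_F`, zero by `h4`, and the Maurer–Cartan terms of `M` and `t`, zero by `h3`.
  rw [h6, h1]
  simp only [smul_sub, Finset.sum_sub_distrib, h2, smul_add, Finset.sum_add_distrib]
  rw [h4, zero_add, eq_neg_of_add_eq_zero_left h3]
  abel

end Trivialisations


/-! ### Existence of trivialisation connective structures -/

section Existence

variable {X : Type*} [TopologicalSpace X] [DiffeologicalSpace X] {G : RigidBundleTwoGerbe X}

/-- Trivialisation connective structures exist. -/
theorem RigidTrivialisation.nonempty_connectiveStructure (hX : IsSmoothManifold X)
    (T : RigidTrivialisation G) (C : RigidConnectiveStructure G) :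
    Nonempty (TrivialisationConnectiveStructure T C.toConnectiveStructure) := by
  have rZ₀ := G.isSmoothlyRegular_Z (n := 0) (by norm_num)
  have rZ₁ := G.isSmoothlyRegular_Z (n := 1) (by norm_num)
  have rY := fun l => G.isSmoothlyRegular_Y.fibProd G.π l
  have s₁ := G.isSubduction_πZ (n := 1) (by norm_num)
  have s₂ := G.isSubduction_πZ (n := 2) (by norm_num)
  have s₃ := G.isSubduction_πZ (n := 3) (by norm_num)
  have lπ := G.submersion.hasLocalSections
  have sE := G.E.bundle.isSubduction (rZ₁.fibProd (G.πZ 1) 2)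
  have hr := RigidTrivialisation.dSmooth_hface_proj G
  -- The connection `w` is final; only `b` and the form `a` found below get corrected.
  obtain ⟨w, b, hw, hb⟩ := T.F.exists_isCurving rZ₀ (rY 1)
    (G.submersionZ 0 (by norm_num)).hasLocalSections
  obtain ⟨η, hη⟩ := T.t.exists_pullsBackTo (rZ₀.fibProd (G.πZ 0) 2) hr hw.1
  obtain ⟨κ, hκ⟩ := C.isConnection.1.exists_sub_eq (rZ₁.fibProd (G.πZ 1) 2)
    (RigidTrivialisation.isConnection_of_pullsBackTo hη)
  obtain ⟨a, rfl⟩ := exists_delta_eq (rY 2) (G.submersionZ 1 (by norm_num)).hasLocalSections κ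
    (RigidTrivialisation.coboundary_eq_zero C.isConnection hw hη hκ)
  obtain ⟨A, hA⟩ := s₂.exists_pullback_eq (isBasic_of_delta_eq_zero
    (RigidTrivialisation.delta_deltaH_sub_eq_zero C.delta_α hη hκ))
  -- `δA = 0` is tested after the injective pullback to `Z_3`, where it becomes `δ_h(δ_h a - α)`;
  -- this vanishes by `δ_h² = 0` and `δ_h α = 0`.
  obtain ⟨A', rfl⟩ := FibProd.exists_coboundary_eq hX.isSmoothlyRegular lπ 1 A
    (s₃.pullback_injective (by
      rw [G.pullback_coboundary 2 (by norm_num), hA, map_sub, G.deltaH_deltaH 1, C.deltaH_α,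
        sub_zero, map_zero]))
  rw [G.pullback_coboundary 1 (by norm_num)] at hA
  let a' := a - Form.pullback (G.πZ 1) s₁.smooth A'
  have ha' : Form.pullback G.E.bundle.proj G.E.bundle.dSmooth_proj (delta (G.πZ 1) a') =
      C.connE - η := by
    rw [map_sub, delta_pullback_eq_zero, sub_zero, hκ]
  have hδa' : G.deltaH 1 (by norm_num) a' = C.α := by
    rw [map_sub, hA, sub_sub_cancel]
  have hdη : Form.d η = Form.pullback G.E.bundle.proj G.E.bundle.dSmooth_proj
      (delta (G.πZ 1) (G.deltaH 0 (by norm_num) b)) := by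
    rw [hη.d_eq (rZ₀.fibProd (G.πZ 0) 2) hr hb, SimplicialSubmersion.delta_deltaH, map_sum]
    refine Finset.sum_congr rfl fun i _ => ?_
    rw [map_zsmul]
    rfl
  -- On `E`, `δ_v β` becomes `d∇_E`, `δ_v δ_h b` becomes `dη`, and `δ_v da'` becomes `d(∇_E - η)`;
  -- the combination cancels.
  obtain ⟨Q, hQ⟩ := s₁.exists_pullback_eq (η := C.β - G.deltaH 0 (by norm_num) b - Form.d a')
    (isBasic_of_delta_eq_zero (sE.pullback_injective (by
      rw [map_sub, map_sub, map_sub, map_sub, C.isCurving, ← hdη, ← d_delta, ← Form.d_pullback,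
        ha', map_sub, sub_self, map_zero])))
  -- On `Z_2` the form `δQ` becomes `δ_h β - d(δ_h a')`. The normalisation `δ_h a' = α` was arranged
  -- in order that this be `δ_h β - dα = 0`.
  obtain ⟨b', rfl⟩ := exists_delta_eq hX.isSmoothlyRegular lπ Q (s₂.pullback_injective (by
    rw [G.pullback_coboundary 1 (by norm_num), hQ, map_sub, map_sub, G.deltaH_deltaH 0,
      ← G.d_deltaH, hδa', C.d_α, sub_zero, sub_self, map_zero]))
  rw [G.pullback_delta] at hQ
  exact ⟨{
    connF := w
    isConnection := hw
    -- A form pulled back from `Y` has zero vertical coboundary, so the curving condition is kept.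
    b := b + Form.pullback G.π₀ G.dSmooth_π₀ b'
    isCurving := by
      rw [BundleGerbe.IsCurving, map_add, G.delta_pullback_π₀, add_zero]
      exact hb
    a := a'
    conn_eq := ⟨η, hη, ha'⟩
    d_a := by
      rw [map_add, hQ]
      abel }⟩

end Existence

end RigidGerbe

end

/-! ### The 4-curvature and its primitive -/

theorem mainTheorem6 {X : Type*} [TopologicalSpace X] [DiffeologicalSpace X]
    (hX : IsSmoothManifold X) (G : RigidBundleTwoGerbe X) (C : RigidConnectiveStructure G)
    (T : RigidTrivialisation G) :
    -- a trivialisation connective structure exists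
    Nonempty (TrivialisationConnectiveStructure T C.toConnectiveStructure) ∧
    -- there is a unique 4-form `H` on `X` with `π^*H = dλ` (the 4-curvature); it is closed
    ∃ H : Form 4 X,
      (Form.pullback G.π G.submersion.smooth H = Form.d C.lam ∧
        ∀ H' : Form 4 X, Form.pullback G.π G.submersion.smooth H' = Form.d C.lam → H' = H) ∧
      Form.d H = 0 ∧
      -- every trivialisation connective structure yields an explicit primitive `R` of `H`
      ∀ S : TrivialisationConnectiveStructure T C.toConnectiveStructure,
        -- there is a unique 3-form `h` on `Y` with `π^*h = db` (the 3-curvature of `(∇_F, b)`)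
        ∃ h : Form 3 G.Y,
          (Form.pullback G.π₀ G.dSmooth_π₀ h = Form.d S.b ∧
            ∀ h' : Form 3 G.Y, Form.pullback G.π₀ G.dSmooth_π₀ h' = Form.d S.b → h' = h) ∧
          -- `h` is closed and a 2-curving for `β`
          Form.d h = 0 ∧
          Form.pullback (G.πZ 1) (G.submersionZ 1 (by norm_num)).smooth (delta G.π h) =
            Form.d C.β ∧
          -- there is a unique 3-form `R` on `X` with `π^*R = λ - h`, and `dR = H`
          ∃ R : Form 3 X,
            (Form.pullback G.π G.submersion.smooth R = C.lam - h ∧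
              ∀ R' : Form 3 X, Form.pullback G.π G.submersion.smooth R' = C.lam - h → R' = R) ∧
            Form.d R = H := by
  refine ⟨RigidTrivialisation.nonempty_connectiveStructure hX T C, ?_⟩
  have sπ := G.isSubduction_π hX
  have sπ₀ := G.isSubduction_π₀
  have sπ₁ := G.isSubduction_πZ (n := 1) (by norm_num)
  -- The descent condition `δζ = 0` lives on `Y^{[2]}`, but the relations for `λ` and `h` are known
  -- only on `Z_1`; injectivity of the pullback bridges the gap.
  have descend : ∀ {k : ℕ} (ζ : Form k G.Y), Form.pullback (G.πZ 1) sπ₁.smooth (delta G.π ζ) = 0 →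
      ∃ ξ : Form k X, Form.pullback G.π sπ.smooth ξ = ζ := fun ζ hζ =>
    sπ.exists_pullback_eq (isBasic_of_delta_eq_zero
      (sπ₁.pullback_injective (hζ.trans (map_zero _).symm)))
  obtain ⟨H, hH⟩ := descend (Form.d C.lam) (by
    rw [← d_delta, ← Form.d_pullback, C.isTwoCurving, Form.d_d])
  refine ⟨H, ⟨hH, fun H' hH' => sπ.pullback_injective (hH'.trans hH.symm)⟩,
    sπ.pullback_injective ?_, fun S => ?_⟩
  · rw [← Form.d_pullback, hH, Form.d_d, map_zero]
  -- `δ_v db` pulls back on the total space of `F` to `dd∇_F = 0`.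
  obtain ⟨h, hh⟩ := sπ₀.exists_pullback_eq (G.isBasic_π₀_of_delta_eq_zero (η := Form.d S.b)
    ((T.F.bundle.isSubduction ((G.isSmoothlyRegular_Z (Nat.zero_le 3)).fibProd _
      2)).pullback_injective (by
        rw [← d_delta, ← Form.d_pullback, S.isCurving, Form.d_d, map_zero])))
  -- `β` and `δ_h b` differ by the exact form `da`, so `dβ = δ_h db`; thus `h` and `λ` have the same
  -- `delta`.
  have hβ : Form.pullback (G.πZ 1) sπ₁.smooth (delta G.π h) = Form.d C.β := by
    rw [G.pullback_delta, hh, ← G.d_deltaH, eq_comm, ← sub_eq_zero, ← map_sub, ← S.d_a, Form.d_d]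
  obtain ⟨R, hR⟩ := descend (C.lam - h) (by
    rw [map_sub, map_sub, C.isTwoCurving, hβ, sub_self])
  have hdh : Form.d h = 0 := sπ₀.pullback_injective (by
    rw [← Form.d_pullback, hh, Form.d_d, map_zero])
  refine ⟨h, ⟨hh, fun h' hh' => sπ₀.pullback_injective (hh'.trans hh.symm)⟩, hdh, hβ, R,
    ⟨hR, fun R' hR' => sπ.pullback_injective (hR'.trans hR.symm)⟩, sπ.pullback_injective ?_⟩
  rw [← Form.d_pullback, hR, map_sub, hdh, sub_zero, hH]
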